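/- Let $\mathcal{H}_a$ and $\mathcal{H}_b$ be complex Hilbert spaces, $\mathcal{H}_a$ of finite dimension $d_a$ and $\mathcal{H}_b$ separable (of finite or infinite dimension), and let $\rho$ be a density matrix (a positive operator of trace $1$) on $\mathcal{H}=\mathcal{H}_a\otimes\mathcal{H}_b$ with operator norm $\|\rho\|<1/4$. Let $\mathrm{GAP}(\rho)$ be the following probability measure on the unit sphere $\mathbb{S}(\mathcal{H})=\{\psi\in\mathcal{H}:\|\psi\|=1\}$. Write $\rho=\sum_n p_n|n\rangle\langle n|$ with an orthonormal basis $(|n\rangle)_n$ of eigenvectors, and let $\mathrm{G}(\rho)$ be the distribution of $\sum_n Z_n|n\rangle$, where the $Z_n$ are independent complex Gaussian random variables with mean $0$ and $\mathbb{E}|Z_n|^2=p_n$ (real and imaginary part independent real Gaussians with mean $0$ and variance $p_n/2$ each); let $\mathrm{GA}(\rho)(d\psi)=\|\psi\|^2\,\mathrm{G}(\rho)(d\psi)$; then $\mathrm{GAP}(\rho)$ is the distribution of $\Psi/\|\Psi\|$ for a $\mathrm{GA}(\rho)$-distributed random vector $\Psi$. For $\psi\in\mathbb{S}(\mathcal{H})$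 let $\rho_a^\psi=\mathrm{tr}_b|\psi\rangle\langle\psi|$, where $\mathrm{tr}_b$ is the partial trace over $\mathcal{H}_b$, and let $\|M\|_{\mathrm{tr}}=\mathrm{tr}\sqrt{M^*M}$ be the trace norm. Then for every $\delta>0$, $$\mathrm{GAP}(\rho)\Bigl\{\psi\in\mathbb{S}(\mathcal{H}):\ \bigl\|\rho_a^\psi-\mathrm{tr}_b\,\rho\bigr\|_{\mathrm{tr}}\le\sqrt{\tfrac{28\,d_a^5\,\mathrm{tr}\,\rho^2}{\delta}}\Bigr\}\ \ge\ 1-\delta .$$ -/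

import Mathlib

open scoped NNReal ENNReal TensorProduct ComplexOrder
open MeasureTheory ProbabilityTheory

namespace QuantumTypicality

universe u v

noncomputable section

/-! ## Traces and density matrices -/

/-- A bounded operator `T` has trace `c`: for every orthonormal basis `b`, the series
`∑ i, ⟪b i, T (b i)⟫` converges unconditionally to `c`.
(Orthonormal bases are indexed by subsets of `H`, which is no loss of generality.) -/
def HasTrace {H : Type u} [NormedAddCommGroup H] [InnerProductSpace ℂ H]
    (T : H →L[ℂ] H) (c : ℂ) : Prop :=
  ∀ (w : Set H) (b : HilbertBasis w ℂ H), HasSum (fun i => inner ℂ (b i) (T (b i))) c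

/-- Some orthonormal basis of a Hilbert space. -/
theorem exists_onb (H : Type u) [NormedAddCommGroup H] [InnerProductSpace ℂ H] [CompleteSpace H] :
    ∃ w : Set H, Nonempty (HilbertBasis w ℂ H) :=
  let ⟨w, b, _⟩ := _root_.exists_hilbertBasis ℂ H
  ⟨w, ⟨b⟩⟩

/-- The index set of a fixed orthonormal basis of `H`. -/
def onbIndex (H : Type u) [NormedAddCommGroup H] [InnerProductSpace ℂ H] [CompleteSpace H] :
    Set H := (exists_onb H).choose

/-- A fixed orthonormal basis of `H`. -/
def onb (H : Type u) [NormedAddCommGroup H] [InnerProductSpace ℂ H] [CompleteSpace H] :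
    HilbertBasis (onbIndex H) ℂ H := (exists_onb H).choose_spec.some

/-- The trace `tr T = ∑ i, ⟪e i, T (e i)⟫` of a trace-class operator on a Hilbert space, computed in
a fixed orthonormal basis (for a trace-class operator the value does not depend on the basis). -/
def opTrace {H : Type u} [NormedAddCommGroup H] [InnerProductSpace ℂ H] [CompleteSpace H]
    (T : H →L[ℂ] H) : ℂ :=
  ∑' i, inner ℂ (onb H i) (T (onb H i))

/-- The trace norm `‖M‖_tr = tr |M| = tr √(M* M)`. -/
def traceNorm {H : Type u} [NormedAddCommGroup H] [InnerProductSpace ℂ H] [CompleteSpace H]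
    (M : H →L[ℂ] H) : ℝ :=
  (opTrace (CFC.sqrt (star M * M))).re

/-- A density matrix: a positive operator of trace one. -/
structure IsDensityMatrix {H : Type u} [NormedAddCommGroup H] [InnerProductSpace ℂ H]
    (ρ : H →L[ℂ] H) : Prop where
  isPositive : ρ.IsPositive
  hasTrace : HasTrace ρ 1

/-! ## Spectral decomposition of a density matrix -/

section Spectral

variable {H : Type u} [NormedAddCommGroup H] [InnerProductSpace ℂ H] [CompleteSpace H]

theorem isCompactOperator_finset_sum_rankOne {ι : Type*} (x y : ι → H) (F : Finset ι) :
    IsCompactOperator (∑ i ∈ F, InnerProductSpace.rankOne ℂ (x i) (y i) : H →L[ℂ] H) := by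
  classical
  induction F using Finset.induction_on with
  | empty => simpa using! (isCompactOperator_zero : IsCompactOperator (0 : H → H))
  | insert a s ha ih =>
    rw [Finset.sum_insert ha]
    refine IsCompactOperator.add ?_ ih
    rw [InnerProductSpace.rankOne_def']
    exact (isCompactOperator_of_locallyCompactSpace_rng
      (ContinuousLinearMap.toSpanSingleton ℂ (x a))).comp_clm (innerSL ℂ (y a))

theorem isCompactOperator_of_summable {ι : Type*} (b : HilbertBasis ι ℂ H) (S : H →L[ℂ] H)
    (hS : S.IsSymmetric) (hs : Summable fun i => ‖S (b i)‖ ^ 2) : IsCompactOperator S := by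
  classical
  have key : ∀ F : Finset ι, ‖S - ∑ i ∈ F, InnerProductSpace.rankOne ℂ (b i) (S (b i))‖ ≤
      √((∑' i, ‖S (b i)‖ ^ 2) - ∑ i ∈ F, ‖S (b i)‖ ^ 2) := by
    intro F
    refine ContinuousLinearMap.opNorm_le_bound _ (Real.sqrt_nonneg _) fun y => ?_
    set z := (S - ∑ i ∈ F, InnerProductSpace.rankOne ℂ (b i) (S (b i))) y with hz
    have hcoord : ∀ i, inner ℂ (b i) z = if i ∈ F then 0 else inner ℂ (S (b i)) y := by
      intro i
      have h1 : inner ℂ (b i) (S y) = inner ℂ (S (b i)) y := (hS (b i) y).symm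
      have h2 : ∀ j, inner ℂ (b i) (b j) = if i = j then (1 : ℂ) else 0 :=
        fun j => (orthonormal_iff_ite.mp b.orthonormal) i j
      simp only [hz, sub_apply, sum_apply,
        InnerProductSpace.rankOne_apply, inner_sub_right, inner_sum, inner_smul_right, h1, h2]
      by_cases hi : i ∈ F <;> simp [hi]
    have hsum : HasSum (fun i => ‖inner ℂ (b i) z‖ ^ 2) (‖z‖ ^ 2) := by
      have h := (b.hasSum_inner_mul_inner z z).mapL Complex.reCLM
      have e2 : Complex.reCLM (inner ℂ z z) = ‖z‖ ^ 2 := by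
        simpa using! inner_self_eq_norm_sq (𝕜 := ℂ) z
      rw [e2] at h
      have e1 : ∀ i, ‖inner ℂ (b i) z‖ ^ 2 =
          Complex.reCLM (inner ℂ z (b i) * inner ℂ (b i) z) := by
        intro i
        rw [← inner_conj_symm z (b i), ← Complex.normSq_eq_conj_mul_self, Complex.normSq_eq_norm_sq,
          Complex.reCLM_apply, Complex.ofReal_re]
      simpa only [e1] using! h
    have htail : HasSum (fun i => if i ∈ F then 0 else ‖S (b i)‖ ^ 2)
        ((∑' i, ‖S (b i)‖ ^ 2) - ∑ i ∈ F, ‖S (b i)‖ ^ 2) := by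
      have h1 : HasSum (fun i => if i ∈ F then ‖S (b i)‖ ^ 2 else 0)
          (∑ i ∈ F, ‖S (b i)‖ ^ 2) := by
        have h2 : ∑ i ∈ F, ‖S (b i)‖ ^ 2 = ∑ i ∈ F, if i ∈ F then ‖S (b i)‖ ^ 2 else 0 :=
          Finset.sum_congr rfl fun i hi => by simp [hi]
        rw [h2]
        exact hasSum_sum_of_ne_finset_zero fun i hi => by simp [hi]
      have e1 : (fun i => if i ∈ F then 0 else ‖S (b i)‖ ^ 2) =
          fun i => ‖S (b i)‖ ^ 2 - if i ∈ F then ‖S (b i)‖ ^ 2 else 0 := by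
        funext i
        by_cases hi : i ∈ F <;> simp [hi]
      rw [e1]
      exact hs.hasSum.sub h1
    have hle : ‖z‖ ^ 2 ≤ ((∑' i, ‖S (b i)‖ ^ 2) - ∑ i ∈ F, ‖S (b i)‖ ^ 2) * ‖y‖ ^ 2 := by
      refine hasSum_le (fun i => ?_) hsum (htail.mul_right (‖y‖ ^ 2))
      rw [hcoord]
      by_cases hi : i ∈ F
      · simp [hi]
      · simp only [hi, if_false]
        rw [← mul_pow]
        exact pow_le_pow_left₀ (norm_nonneg _) (norm_inner_le_norm _ _) 2
    calc ‖z‖ = √(‖z‖ ^ 2) := (Real.sqrt_sq (norm_nonneg _)).symm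
      _ ≤ √(((∑' i, ‖S (b i)‖ ^ 2) - ∑ i ∈ F, ‖S (b i)‖ ^ 2) * ‖y‖ ^ 2) := Real.sqrt_le_sqrt hle
      _ = _ := by rw [Real.sqrt_mul' _ (sq_nonneg _), Real.sqrt_sq (norm_nonneg _)]
  refine isCompactOperator_of_tendsto (l := Filter.atTop (α := Finset ι))
    (F := fun F => ∑ i ∈ F, InnerProductSpace.rankOne ℂ (b i) (S (b i))) ?_
    (Filter.Eventually.of_forall fun F => isCompactOperator_finset_sum_rankOne _ _ F)
  rw [tendsto_iff_norm_sub_tendsto_zero]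
  have h0 : Filter.Tendsto
      (fun F : Finset ι => √((∑' i, ‖S (b i)‖ ^ 2) - ∑ i ∈ F, ‖S (b i)‖ ^ 2))
      Filter.atTop (nhds 0) := by
    have := (Filter.Tendsto.const_sub (∑' i, ‖S (b i)‖ ^ 2) hs.hasSum).sqrt
    simpa using! this
  refine squeeze_zero (fun _ => norm_nonneg _) (fun F => ?_) h0
  rw [norm_sub_rev]
  exact key F

theorem IsDensityMatrix.isCompactOperator {ρ : H →L[ℂ] H} (hρ : IsDensityMatrix ρ) :
    IsCompactOperator ρ := by
  have h0 : (0 : H →L[ℂ] H) ≤ ρ := (ContinuousLinearMap.nonneg_iff_isPositive ρ).mpr hρ.isPositive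
  have hSpos : (CFC.sqrt ρ).IsPositive :=
    (ContinuousLinearMap.nonneg_iff_isPositive _).mp (CFC.sqrt_nonneg ρ)
  have hSS : CFC.sqrt ρ * CFC.sqrt ρ = ρ := CFC.sqrt_mul_sqrt_self ρ h0
  have hsum := hρ.hasTrace _ (onb H)
  have hs : Summable fun i => ‖CFC.sqrt ρ (onb H i)‖ ^ 2 := by
    have h := (hsum.mapL Complex.reCLM).summable
    refine h.congr fun i => ?_
    have e : inner ℂ (onb H i) (ρ (onb H i)) =
        inner ℂ (CFC.sqrt ρ (onb H i)) (CFC.sqrt ρ (onb H i)) := by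
      conv_lhs => rw [← hSS]
      exact (hSpos.isSymmetric _ _).symm
    rw [e]
    simpa using! inner_self_eq_norm_sq (𝕜 := ℂ) (CFC.sqrt ρ (onb H i))
  have hc := isCompactOperator_of_summable (onb H) (CFC.sqrt ρ) hSpos.isSymmetric hs
  rw [← hSS]
  exact hc.comp_clm (CFC.sqrt ρ)

/-- Every density matrix has an orthonormal basis of eigenvectors, with eigenvalues `≥ 0`. -/
theorem IsDensityMatrix.exists_eigenbasis {ρ : H →L[ℂ] H} (hρ : IsDensityMatrix ρ) :
    ∃ (w : Set H) (b : HilbertBasis w ℂ H) (p : w → ℝ≥0),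
      ∀ i, ρ (b i) = ((p i : ℝ) : ℂ) • b i := by
  have hsymm : ρ.IsSymmetric := hρ.isPositive.isSymmetric
  have hbot := ContinuousLinearMap.orthogonalComplement_iSup_eigenspaces_eq_bot
    hρ.isCompactOperator hsymm
  have hex : ∀ μ : ℂ, ∃ w : Set (Module.End.eigenspace (ρ : Module.End ℂ H) μ),
      Nonempty (HilbertBasis w ℂ (Module.End.eigenspace (ρ : Module.End ℂ H) μ)) := by
    intro μ
    have : CompleteSpace (Module.End.eigenspace (ρ : Module.End ℂ H) μ) := by
      refine IsClosed.completeSpace_coe (hs := ?_)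
      have : (Module.End.eigenspace (ρ : Module.End ℂ H) μ : Set H) = {x | ρ x = μ • x} := by
        ext x; simp
      rw [this]
      exact isClosed_eq ρ.continuous (continuous_const_smul μ)
    exact exists_onb _
  choose w hw using hex
  let e := fun μ => (hw μ).some
  let f : (Σ μ : ℂ, w μ) → H := fun a => (e a.1 a.2 : H)
  have hf : Orthonormal ℂ f :=
    hsymm.orthogonalFamily_eigenspaces.orthonormal_sigma_orthonormal
      (fun μ => (e μ).orthonormal)
  have hfe : ∀ a, ρ (f a) = a.1 • f a := fun a =>
    Module.End.mem_eigenspace_iff.mp (e a.1 a.2).2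
  have hperp : (Submodule.span ℂ (Set.range f))ᗮ = ⊥ := by
    rw [eq_bot_iff, ← hbot]
    intro x hx
    rw [Submodule.mem_orthogonal] at hx
    have hμ : ∀ μ, Module.End.eigenspace (ρ : Module.End ℂ H) μ ≤ (ℂ ∙ x)ᗮ := by
      intro μ y hy
      rw [Submodule.mem_orthogonal_singleton_iff_inner_left]
      have h := ((e μ).hasSum_repr ⟨y, hy⟩).mapL
        (Submodule.subtypeL (Module.End.eigenspace (ρ : Module.End ℂ H) μ))
      have h' := (h.mapL (innerSL ℂ x))
      have hz : ∀ i, innerSL ℂ x (Submodule.subtypeL _ ((e μ).repr ⟨y, hy⟩ i • e μ i)) = 0 := by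
        intro i
        have := hx (f ⟨μ, i⟩) (Submodule.subset_span ⟨_, rfl⟩)
        rw [inner_eq_zero_symm] at this
        simpa [f, inner_smul_right] using Or.inr this
      simp only [hz] at h'
      have := h'.unique hasSum_zero
      rw [inner_eq_zero_symm]
      simpa using this
    rw [Submodule.mem_orthogonal]
    intro y hy
    have := (iSup_le hμ) hy
    rwa [Submodule.mem_orthogonal_singleton_iff_inner_left] at this
  have hg : Orthonormal ℂ (Subtype.val : Set.range f → H) := hf.toSubtypeRange
  let b := HilbertBasis.mkOfOrthogonalEqBot hg (by rwa [Subtype.range_coe])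
  have hb : ∀ i, b i = (i : H) := fun i => by simp [b]
  have hp : ∀ i : Set.range f, ∃ p : ℝ≥0, ρ (b i) = ((p : ℝ) : ℂ) • b i := by
    rintro ⟨_, a, rfl⟩
    have h0 := hρ.isPositive.inner_nonneg_right (f a)
    rw [hfe, inner_smul_right, inner_self_eq_norm_sq_to_K, hf.1 a] at h0
    simp only [Complex.coe_algebraMap, Complex.ofReal_one, one_pow, mul_one] at h0
    obtain ⟨hre, him⟩ := Complex.nonneg_iff.mp h0
    refine ⟨⟨a.1.re, hre⟩, ?_⟩
    rw [hb, hfe]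
    congr 1
    exact Complex.ext rfl (by simpa using! him.symm)
  choose p hp using hp
  exact ⟨_, b, p, hp⟩

end Spectral

/-! ## The Gaussian measure `G(ρ)` and the measures `GA(ρ)`, `GAP(ρ)` -/

/-- The law of a complex Gaussian variable with mean `0` and variance `E |Z|² = p`: real and
imaginary part are independent real Gaussians with mean `0` and variance `p / 2`. -/
def complexGaussian (p : ℝ≥0) : Measure ℂ :=
  ((gaussianReal 0 (p / 2)).prod (gaussianReal 0 (p / 2))).map
    (fun x : ℝ × ℝ => (⟨x.1, x.2⟩ : ℂ))

/-- The law of the random vector `∑ i, Z i • b i`, where the `Z i` are independent complex Gaussian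
variables with mean `0` and variances `p i`. -/
def gaussianOfBasis {H : Type u} [NormedAddCommGroup H] [InnerProductSpace ℂ H]
    [MeasurableSpace H] {ι : Type*} (b : HilbertBasis ι ℂ H) (p : ι → ℝ≥0) : Measure H :=
  (Measure.infinitePi fun i => complexGaussian (p i)).map (fun z : ι → ℂ => ∑' i, z i • b i)

section GAP

variable {H : Type u} [NormedAddCommGroup H] [InnerProductSpace ℂ H] [CompleteSpace H]
  [MeasurableSpace H]

/-- The Gaussian measure `G(ρ)` on `H` with mean `0` and covariance operator `ρ`, constructed from an
orthonormal basis of eigenvectors of `ρ`. -/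
def gaussianMeasure (ρ : H →L[ℂ] H) (hρ : IsDensityMatrix ρ) : Measure H :=
  gaussianOfBasis hρ.exists_eigenbasis.choose_spec.choose
    hρ.exists_eigenbasis.choose_spec.choose_spec.choose

/-- The adjusted Gaussian measure `GA(ρ)(dψ) = ‖ψ‖² G(ρ)(dψ)`. -/
def adjustedGaussian (ρ : H →L[ℂ] H) (hρ : IsDensityMatrix ρ) : Measure H :=
  (gaussianMeasure ρ hρ).withDensity fun ψ => ENNReal.ofReal (‖ψ‖ ^ 2)

/-- The measure `GAP(ρ)` on the unit sphere: the law of `Ψ / ‖Ψ‖` for `Ψ` distributed according to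
`GA(ρ)`. The law of `Ψ / ‖Ψ‖` on `H` is carried by the unit sphere (`Ψ ≠ 0` almost surely), and is
regarded as a measure on the subtype by means of `Measure.comap`. -/
def GAP (ρ : H →L[ℂ] H) (hρ : IsDensityMatrix ρ) : Measure (Metric.sphere (0 : H) 1) :=
  ((adjustedGaussian ρ hρ).map fun ψ => ((‖ψ‖⁻¹ : ℝ) : ℂ) • ψ).comap Subtype.val

end GAP

/-! ## Bipartite systems -/

/-- The Hilbert space tensor product: the completion of the algebraic tensor product with respect to
the inner product `⟪x ⊗ y, x' ⊗ y'⟫ = ⟪x, x'⟫ * ⟪y, y'⟫`. -/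
abbrev HilbertTensor (Ha : Type u) (Hb : Type v) [NormedAddCommGroup Ha] [InnerProductSpace ℂ Ha]
    [NormedAddCommGroup Hb] [InnerProductSpace ℂ Hb] : Type (max u v) :=
  UniformSpace.Completion (Ha ⊗[ℂ] Hb)

section Bipartite

variable {Ha : Type u} {Hb : Type v} [NormedAddCommGroup Ha] [InnerProductSpace ℂ Ha]
  [NormedAddCommGroup Hb] [InnerProductSpace ℂ Hb]

instance : MeasurableSpace (HilbertTensor Ha Hb) := borel _

instance : BorelSpace (HilbertTensor Ha Hb) := ⟨rfl⟩

/-- For `y : Hb`, the bounded operator `x ↦ x ⊗ y` from `Ha` to `Ha ⊗ Hb`. -/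
def tensorRight (Ha : Type u) {Hb : Type v} [NormedAddCommGroup Ha] [InnerProductSpace ℂ Ha]
    [NormedAddCommGroup Hb] [InnerProductSpace ℂ Hb] (y : Hb) : Ha →L[ℂ] HilbertTensor Ha Hb :=
  (UniformSpace.Completion.toComplL : Ha ⊗[ℂ] Hb →L[ℂ] HilbertTensor Ha Hb) ∘L
    (TensorProduct.mkL ℂ Ha Hb).flip y

/-- The partial trace `tr_b T = ∑ n, ⟨n|_b T |n⟩_b` over an orthonormal basis of `Hb`; that is,
`⟪x, (tr_b T) x'⟫ = ∑ n, ⟪x ⊗ n, T (x' ⊗ n)⟫`. -/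
def partialTrace [CompleteSpace Ha] [CompleteSpace Hb]
    (T : HilbertTensor Ha Hb →L[ℂ] HilbertTensor Ha Hb) : Ha →L[ℂ] Ha :=
  ∑' n, (ContinuousLinearMap.adjoint (tensorRight Ha (onb Hb n))) ∘L T ∘L
    (tensorRight Ha (onb Hb n))

/-- The reduced density matrix `ρ_a^ψ = tr_b |ψ⟩⟨ψ|`. -/
def reducedDensity [CompleteSpace Ha] [CompleteSpace Hb] (ψ : HilbertTensor Ha Hb) : Ha →L[ℂ] Ha :=
  partialTrace (InnerProductSpace.rankOne ℂ ψ ψ)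

end Bipartite

end

end QuantumTypicality

namespace QuantumTypicality

open ComplexConjugate Filter Topology

/-! ### Moments of real and complex Gaussian variables -/

/-! Fix an orthonormal basis `e` of `Ha`. The matrix element `⟪e i, ρ_a^ψ (e j)⟫` is the quadratic
form `⟪ψ, A ψ⟫` of `A = |e j⟩⟨e i| ⊗ 1`, an operator of norm at most `1`, and the same matrix
element of `tr_b ρ` is `a = tr (A ρ)`. On the unit sphere their difference is `⟪ψ, B ψ⟫` with `B = A
- a • 1`, where `‖B‖ ≤ 2` and `tr (B ρ) = 0`. The trace norm is at most `√d_a` times the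
Hilbert–Schmidt norm (`traceNorm_le_sqrt`), so it suffices to bound the second moments of these
`d_a²` forms.

Under `G(ρ)`, Wick's formula makes the centred monomials in the `Z_n` orthogonal. The variance of
`⟪ψ, B ψ⟫` is therefore controlled by `∑ |B_mn|² p_m p_n ≤ ‖B‖² tr ρ²`
(`lintegral_sq_norm_inner_sub_le`); Fatou's lemma covers infinite dimension.

Under `GAP(ρ)`, the weight `‖ψ‖²` and the normalization turn the second moment into `∫ |⟪ψ, B ψ⟫|² /
‖ψ‖² dG`. The denominator does no harm: `|⟪ψ, B ψ⟫| ≤ 2 ‖ψ‖²` handles small `ψ`, and `‖ψ‖²` is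
concentrated at `1`, being the quadratic form of the identity. This costs at most `16 tr ρ²` per
matrix element (`sq_div_le_of_le_mul`), and Chebyshev's inequality (`one_sub_le_GAP_real`)
concludes, with room to spare in the constant and in the power of `d_a`. -/

theorem deriv_mul_exp_sq (v : ℝ) (f f' : ℝ → ℝ) (hf : ∀ t, HasDerivAt f (f' t) t) :
    deriv (fun t => f t * Real.exp (v * t ^ 2 / 2)) =
      fun t => (f' t + v * t * f t) * Real.exp (v * t ^ 2 / 2) := by
  funext t
  have h1 : HasDerivAt (fun t : ℝ => v * t ^ 2 / 2) (v * t) t := by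
    have := (((hasDerivAt_id t).pow 2).const_mul v).div_const 2
    refine this.congr_deriv ?_
    simp only [id, Nat.cast_ofNat]
    ring
  refine ((hf t).mul h1.exp).deriv.trans ?_
  ring

/-- Each derivative of `exp (v t² / 2)` is a polynomial times the same exponential, so four
applications of one product rule yield the second and fourth moments. -/
theorem iteratedDeriv_mgf_gaussianReal (v : ℝ≥0) :
    iteratedDeriv 2 (mgf id (gaussianReal 0 v)) 0 = v ∧
      iteratedDeriv 4 (mgf id (gaussianReal 0 v)) 0 = 3 * v ^ 2 := by
  have h0 : mgf id (gaussianReal 0 v) = fun t => (fun _ => (1 : ℝ)) t * Real.exp (v * t ^ 2 / 2) := by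
    rw [mgf_id_gaussianReal]; funext t; simp
  have d1 := deriv_mul_exp_sq v (fun _ => 1) (fun _ => 0) (fun t => hasDerivAt_const t 1)
  have d2 := deriv_mul_exp_sq v (fun t => 0 + v * t * 1) (fun _ => v)
    (fun t => by simpa using (hasDerivAt_id t).const_mul (v : ℝ))
  have d3 := deriv_mul_exp_sq v (fun t => v + v * t * (0 + v * t * 1)) (fun t => 2 * v ^ 2 * t)
    (fun t => by
      have := ((((hasDerivAt_id t).pow 2).const_mul ((v : ℝ) ^ 2))).const_add (v : ℝ)
      refine (this.congr_deriv ?_).congr_of_eventuallyEq (Filter.Eventually.of_forall fun s => ?_)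
      · simp only [id, Nat.cast_ofNat]; ring
      · simp only [Pi.pow_apply, id]; ring)
  have d4 := deriv_mul_exp_sq v
    (fun t => 2 * v ^ 2 * t + v * t * (v + v * t * (0 + v * t * 1)))
    (fun t => 3 * v ^ 2 + 3 * v ^ 3 * t ^ 2)
    (fun t => by
      have := ((hasDerivAt_id t).const_mul (3 * (v : ℝ) ^ 2)).add
        (((hasDerivAt_id t).pow 3).const_mul ((v : ℝ) ^ 3))
      refine (this.congr_deriv ?_).congr_of_eventuallyEq (Filter.Eventually.of_forall fun s => ?_)
      · simp only [id, Nat.cast_ofNat]; ring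
      · simp only [Pi.add_apply, Pi.pow_apply, id]; ring)
  rw [h0]
  simp only [iteratedDeriv_succ, iteratedDeriv_zero]
  rw [d1, d2]
  refine ⟨by simp, ?_⟩
  rw [d3, d4]
  simp

theorem integral_pow_two_gaussianReal (v : ℝ≥0) : ∫ x, x ^ 2 ∂gaussianReal 0 v = v := by
  have h := iteratedDeriv_mgf_zero (X := id) (μ := gaussianReal 0 v)
    (by rw [integrableExpSet_id_gaussianReal]; simp) 2
  rw [(iteratedDeriv_mgf_gaussianReal v).1] at h
  simpa using h.symm

theorem integral_pow_four_gaussianReal (v : ℝ≥0) :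
    ∫ x, x ^ 4 ∂gaussianReal 0 v = 3 * (v : ℝ) ^ 2 := by
  have h := iteratedDeriv_mgf_zero (X := id) (μ := gaussianReal 0 v)
    (by rw [integrableExpSet_id_gaussianReal]; simp) 4
  rw [(iteratedDeriv_mgf_gaussianReal v).2] at h
  simpa using h.symm

theorem integrable_pow_gaussianReal (v : ℝ≥0) (n : ℕ) :
    Integrable (fun x : ℝ => x ^ n) (gaussianReal 0 v) := by
  have h := (memLp_id_gaussianReal (μ := 0) (v := v) (n : ℝ≥0)).integrable_norm_pow'
  refine (integrable_norm_iff (by fun_prop)).mp ?_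
  simpa using h

theorem measurable_complex_mk : Measurable (fun x : ℝ × ℝ => (⟨x.1, x.2⟩ : ℂ)) :=
  Complex.measurableEquivRealProd.symm.measurable

instance (p : ℝ≥0) : IsProbabilityMeasure (complexGaussian p) :=
  Measure.isProbabilityMeasure_map measurable_complex_mk.aemeasurable

theorem memLp_complexGaussian (p q : ℝ≥0) : MemLp id q (complexGaussian p) := by
  unfold complexGaussian
  rw [memLp_map_measure_iff aestronglyMeasurable_id measurable_complex_mk.aemeasurable]
  have h1 := (memLp_id_gaussianReal (μ := 0) (v := p / 2) q).comp_fst (gaussianReal 0 (p / 2))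
  have h2 := (memLp_id_gaussianReal (μ := 0) (v := p / 2) q).comp_snd (gaussianReal 0 (p / 2))
  refine (h1.norm.add h2.norm).mono measurable_complex_mk.aestronglyMeasurable
    (Filter.Eventually.of_forall fun x => ?_)
  refine (Complex.norm_le_abs_re_add_abs_im _).trans ?_
  exact le_abs_self _

/-- The quarter turn `(x, y) ↦ (-y, x)` is a swap of two identically distributed coordinates
followed by a reflection of a symmetric one. This much phase invariance suffices for the moments
needed. -/
theorem complexGaussian_map_mul_I (p : ℝ≥0) :
    (complexGaussian p).map (fun z => Complex.I * z) = complexGaussian p := by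
  have hneg : (gaussianReal 0 (p / 2)).map (fun x => -x) = gaussianReal 0 (p / 2) := by
    rw [gaussianReal_map_neg, neg_zero]
  have hrot : ((gaussianReal 0 (p / 2)).prod (gaussianReal 0 (p / 2))).map
      (Prod.map (fun x => -x) id ∘ Prod.swap) =
      (gaussianReal 0 (p / 2)).prod (gaussianReal 0 (p / 2)) := by
    rw [← Measure.map_map (by fun_prop) measurable_swap, Measure.prod_swap,
      ← Measure.map_prod_map _ _ (by fun_prop) measurable_id, hneg, Measure.map_id]
  unfold complexGaussian
  conv_rhs => rw [← hrot]
  rw [Measure.map_map (by fun_prop) measurable_complex_mk,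
    Measure.map_map measurable_complex_mk (by fun_prop)]
  congr 1
  funext x
  simp [Complex.ext_iff]

/-- Invariance under multiplication by `I` multiplies the integral by `I ^ (b - a)`. For exponents
at most `2`, this factor is `1` only if `a = b`. -/
theorem integral_conj_pow_mul_pow_of_ne (p : ℝ≥0) {a b : ℕ} (ha : a ≤ 2) (hb : b ≤ 2)
    (hab : a ≠ b) : ∫ z, conj z ^ a * z ^ b ∂complexGaussian p = 0 := by
  have h : ∫ z, conj z ^ a * z ^ b ∂complexGaussian p =
      conj Complex.I ^ a * Complex.I ^ b * ∫ z, conj z ^ a * z ^ b ∂complexGaussian p := by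
    conv_lhs => rw [← complexGaussian_map_mul_I p]
    rw [integral_map (by fun_prop) (by fun_prop), ← integral_const_mul]
    congr 1
    funext z
    rw [map_mul, mul_pow, mul_pow]
    ring
  have hne : conj Complex.I ^ a * Complex.I ^ b ≠ 1 := by
    interval_cases a <;> interval_cases b <;> simp_all [Complex.ext_iff] <;> norm_num
  by_contra h0
  exact hne (mul_right_cancel₀ h0 (by rw [← h, one_mul]))

theorem integral_normSq_complexGaussian (p : ℝ≥0) :
    ∫ z, ‖z‖ ^ 2 ∂complexGaussian p = p := by
  have h2 := integrable_pow_gaussianReal (p / 2) 2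
  unfold complexGaussian
  rw [integral_map measurable_complex_mk.aemeasurable (by fun_prop)]
  have e : ∀ x : ℝ × ℝ, ‖(⟨x.1, x.2⟩ : ℂ)‖ ^ 2 = x.1 ^ 2 + x.2 ^ 2 := fun x => by
    rw [Complex.sq_norm, Complex.normSq_mk]; ring
  simp_rw [e]
  rw [integral_add (h2.comp_fst _) (h2.comp_snd _), integral_fun_fst (f := fun x : ℝ => x ^ 2),
    integral_fun_snd (f := fun x : ℝ => x ^ 2), integral_pow_two_gaussianReal]
  simp

theorem integral_norm_pow_four_complexGaussian (p : ℝ≥0) :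
    ∫ z, ‖z‖ ^ 4 ∂complexGaussian p = 2 * (p : ℝ) ^ 2 := by
  have h2 := integrable_pow_gaussianReal (p / 2) 2
  have h4 := integrable_pow_gaussianReal (p / 2) 4
  unfold complexGaussian
  rw [integral_map measurable_complex_mk.aemeasurable (by fun_prop)]
  have e : ∀ x : ℝ × ℝ, ‖(⟨x.1, x.2⟩ : ℂ)‖ ^ 4 = x.1 ^ 4 + x.2 ^ 4 + 2 * (x.1 ^ 2 * x.2 ^ 2) :=
    fun x => by
      rw [show 4 = 2 * 2 by norm_num, pow_mul ‖_‖, Complex.sq_norm, Complex.normSq_mk]; ring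
  simp_rw [e]
  have h44 : Integrable (fun x : ℝ × ℝ => x.1 ^ 4 + x.2 ^ 4)
      ((gaussianReal 0 (p / 2)).prod (gaussianReal 0 (p / 2))) :=
    (h4.comp_fst _).add (h4.comp_snd _)
  rw [integral_add h44 ((h2.mul_prod h2).const_mul 2),
    integral_add (h4.comp_fst _) (h4.comp_snd _), integral_fun_fst (f := fun x : ℝ => x ^ 4),
    integral_fun_snd (f := fun x : ℝ => x ^ 4), integral_const_mul,
    integral_prod_mul (fun x : ℝ => x ^ 2) (fun x : ℝ => x ^ 2),
    integral_pow_two_gaussianReal, integral_pow_four_gaussianReal]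
  simp
  ring

theorem integral_conj_mul_self (p : ℝ≥0) : ∫ z, conj z * z ∂complexGaussian p = p := by
  have : ∀ z : ℂ, conj z * z = ((‖z‖ ^ 2 : ℝ) : ℂ) := fun z => by
    rw [← Complex.normSq_eq_conj_mul_self, Complex.normSq_eq_norm_sq]
  simp_rw [this]
  rw [integral_complex_ofReal, integral_normSq_complexGaussian]

theorem integral_conj_sq_mul_sq (p : ℝ≥0) :
    ∫ z, conj z ^ 2 * z ^ 2 ∂complexGaussian p = 2 * (p : ℂ) ^ 2 := by
  have : ∀ z : ℂ, conj z ^ 2 * z ^ 2 = ((‖z‖ ^ 4 : ℝ) : ℂ) := fun z => by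
    rw [← mul_pow, ← Complex.normSq_eq_conj_mul_self, Complex.normSq_eq_norm_sq]
    push_cast; ring
  simp_rw [this]
  rw [integral_complex_ofReal, integral_norm_pow_four_complexGaussian]
  push_cast
  rfl

/-! ### Wick's formula for finitely many independent complex Gaussian variables -/

section Wick

variable {ι : Type*} (p : ι → ℝ≥0)

theorem integral_prod_infinitePi (F : Finset ι) (f : ι → ℂ → ℂ) (hf : ∀ i, Measurable (f i)) :
    ∫ z, ∏ i ∈ F, f i (z i) ∂Measure.infinitePi (fun i => complexGaussian (p i)) =
      ∏ i ∈ F, ∫ x, f i x ∂complexGaussian (p i) := by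
  have hind : iIndepFun (fun (i : F) (z : ι → ℂ) => f i (z i))
      (Measure.infinitePi fun i => complexGaussian (p i)) :=
    (iIndepFun_infinitePi (P := fun i => complexGaussian (p i)) hf).precomp
      Subtype.val_injective
  have h := hind.integral_fun_prod_eq_prod_integral
    (fun i => ((hf i).comp (measurable_pi_apply _)).aestronglyMeasurable)
  rw [← Finset.prod_coe_sort F fun i => ∫ x, f i x ∂complexGaussian (p i)]
  simp_rw [← Finset.prod_coe_sort F]
  rw [h]
  refine Finset.prod_congr rfl fun i _ => ?_
  rw [← Measure.infinitePi_map_eval (fun i => complexGaussian (p i)) (i : ι),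
    integral_map (measurable_pi_apply _).aemeasurable (hf i).aestronglyMeasurable]

theorem lintegral_sq_norm_eval_infinitePi (i : ι) :
    ∫⁻ z, ENNReal.ofReal (‖z i‖ ^ 2) ∂Measure.infinitePi (fun i => complexGaussian (p i)) =
      p i := by
  have h := (measurePreserving_eval_infinitePi (fun i => complexGaussian (p i)) i).lintegral_comp
    (f := fun x : ℂ => ENNReal.ofReal (‖x‖ ^ 2)) (by fun_prop)
  refine h.trans ?_
  have hint : Integrable (fun x : ℂ => ‖x‖ ^ 2) (complexGaussian (p i)) :=
    (memLp_complexGaussian (p i) ((2 : ℕ) : ℝ≥0)).integrable_norm_pow'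
  rw [← ofReal_integral_eq_lintegral_ofReal hint (Filter.Eventually.of_forall fun z => by positivity)]
  exact (congrArg ENNReal.ofReal (integral_normSq_complexGaussian (p i))).trans
    (ENNReal.ofReal_coe_nnreal)

theorem integral_quadratic_monomial [DecidableEq ι] (m n : ι) :
    ∫ z, conj (z m) * z n ∂Measure.infinitePi (fun i => complexGaussian (p i)) =
      if m = n then (p m : ℂ) else 0 := by
  have h := integral_prod_infinitePi p {m, n}
    (fun i x => conj x ^ (if i = m then 1 else 0) * x ^ (if i = n then 1 else 0))
    (fun i => by fun_prop)
  have e : ∀ z : ι → ℂ, ∏ i ∈ ({m, n} : Finset ι), (conj (z i) ^ (if i = m then 1 else 0) *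
      z i ^ (if i = n then 1 else 0)) = conj (z m) * z n := fun z => by
    simp only [Finset.prod_mul_distrib, pow_ite, pow_one, pow_zero, Finset.prod_ite_eq']
    simp
  simp_rw [e] at h
  rw [h]
  split_ifs with hmn
  · subst hmn
    simp [integral_conj_mul_self]
  · refine Finset.prod_eq_zero (i := m) (by simp) ?_
    rw [if_pos rfl, if_neg hmn]
    exact integral_conj_pow_mul_pow_of_ne _ (by norm_num) (by norm_num) (by norm_num)

/-- By independence the expectation factors over the distinct indices, with `a i` conjugated and `b
i` plain factors at `i`. It vanishes unless `a = b`, that is, unless conjugated and plain indices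
can be paired off. -/
theorem integral_quartic_monomial [DecidableEq ι] (m n k l : ι) :
    ∫ z, conj (z m) * z n * (z k * conj (z l))
        ∂Measure.infinitePi (fun i => complexGaussian (p i)) =
      (if m = n ∧ k = l then (p m * p k : ℂ) else 0) +
        if m = k ∧ n = l then (p m * p n : ℂ) else 0 := by
  set F : Finset ι := {m, n, k, l} with hF
  set a : ι → ℕ := fun i => (if i = m then 1 else 0) + (if i = l then 1 else 0) with ha
  set b : ι → ℕ := fun i => (if i = n then 1 else 0) + (if i = k then 1 else 0) with hb
  have h := integral_prod_infinitePi p F (fun i x => conj x ^ a i * x ^ b i)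
    (fun i => by fun_prop)
  have e : ∀ z : ι → ℂ, ∏ i ∈ F, (conj (z i) ^ a i * z i ^ b i) =
      conj (z m) * z n * (z k * conj (z l)) := fun z => by
    simp only [ha, hb, pow_add, Finset.prod_mul_distrib, pow_ite, pow_one, pow_zero,
      Finset.prod_ite_eq']
    simp only [hF, Finset.mem_insert, Finset.mem_singleton, true_or, or_true, if_true]
    ring
  simp_rw [e] at h
  rw [h]
  have hzero : ∀ i ∈ F, a i ≠ b i →
      ∏ i ∈ F, ∫ x, conj x ^ a i * x ^ b i ∂complexGaussian (p i) = 0 := fun i hi hab =>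
    Finset.prod_eq_zero hi (integral_conj_pow_mul_pow_of_ne _
      (by simp only [ha]; split_ifs <;> norm_num) (by simp only [hb]; split_ifs <;> norm_num) hab)
  -- The extra term at `c = d` reflects `E |Z|⁴ = 2 p²`: there both pairings are possible and each
  -- contributes `p²`.
  have hdiag : ∀ c d : ι, c ∈ F → d ∈ F →
      (∀ i, a i = (if i = c then 1 else 0) + (if i = d then 1 else 0)) →
      (∀ i, b i = (if i = c then 1 else 0) + (if i = d then 1 else 0)) →
      ∏ i ∈ F, ∫ x, conj x ^ a i * x ^ b i ∂complexGaussian (p i) =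
        (p c * p d : ℂ) + if c = d then (p c * p d : ℂ) else 0 := by
    intro c d hc hd hac hbc
    by_cases hcd : c = d
    · subst hcd
      have : ∀ i ∈ F, ∫ x, conj x ^ a i * x ^ b i ∂complexGaussian (p i) =
          if i = c then 2 * (p c : ℂ) ^ 2 else 1 := by
        intro i _
        rw [hac, hbc]
        by_cases hi : i = c
        · subst hi
          simp only [if_true, Nat.reduceAdd]
          exact integral_conj_sq_mul_sq _
        · simp [hi]
      rw [Finset.prod_congr rfl this, Finset.prod_ite_eq', if_pos hc, if_pos rfl]
      ring
    · have : ∀ i ∈ F, ∫ x, conj x ^ a i * x ^ b i ∂complexGaussian (p i) =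
          (if i = c then (p c : ℂ) else 1) * if i = d then (p d : ℂ) else 1 := by
        intro i _
        rw [hac, hbc]
        by_cases hi : i = c
        · subst hi
          simp [hcd, integral_conj_mul_self]
        · by_cases hi' : i = d
          · subst hi'
            simp [hi, integral_conj_mul_self]
          · simp [hi, hi']
      rw [Finset.prod_congr rfl this, Finset.prod_mul_distrib, Finset.prod_ite_eq',
        Finset.prod_ite_eq', if_pos hc, if_pos hd, if_neg hcd, add_zero]
  have hmF : m ∈ F := by simp [hF]
  have hkF : k ∈ F := by simp [hF]
  have hlF : l ∈ F := by simp [hF]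
  by_cases hmn : m = n
  · by_cases hkl : k = l
    · rw [hdiag m k hmF hkF (fun i => by simp [ha, hkl]) (fun i => by simp [hb, hmn])]
      subst hmn hkl
      by_cases hmk : m = k <;> simp [hmk]
    · rw [hzero l hlF (by simp only [ha, hb, hmn, if_true, Ne.symm hkl, if_false]; omega)]
      simp only [hmn, hkl, and_false, if_false, zero_add]
      rw [if_neg]
      rintro ⟨rfl, rfl⟩
      exact hkl rfl
  · by_cases hmk : m = k
    · by_cases hnl : n = l
      · have hml : m ≠ l := hnl ▸ hmn
        rw [hdiag m l hmF hlF (fun i => by simp [ha])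
          (fun i => by simp [hb, hmk, hnl, add_comm])]
        simp [hmk, hnl, hmk ▸ hml]
      · rw [hzero l hlF (by simp only [ha, hb, hmk, if_true, Ne.symm hnl, if_false]; omega)]
        simp [hmn, hnl]
    · rw [hzero m hmF (by simp [ha, hb, hmn, hmk])]
      simp [hmn, hmk]

theorem memLp_eval_infinitePi (i : ι) (q : ℝ≥0) :
    MemLp (fun z : ι → ℂ => z i) q (Measure.infinitePi fun i => complexGaussian (p i)) := by
  exact (memLp_complexGaussian (p i) q).comp_measurePreserving
    (measurePreserving_eval_infinitePi (fun i => complexGaussian (p i)) i)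

theorem memLp_two_conj_mul (m n : ι) :
    MemLp (fun z : ι → ℂ => conj (z m) * z n) 2
      (Measure.infinitePi fun i => complexGaussian (p i)) := by
  have hm : Measurable fun z : ι → ℂ => conj (z m) * z n :=
    (Complex.continuous_conj.measurable.comp (measurable_pi_apply m)).mul (measurable_pi_apply n)
  have h4 : ∀ i, Integrable (fun z : ι → ℂ => ‖z i‖ ^ 4)
      (Measure.infinitePi fun i => complexGaussian (p i)) := fun i =>
    (memLp_eval_infinitePi p i ((4 : ℕ) : ℝ≥0)).integrable_norm_pow'
  rw [memLp_two_iff_integrable_sq_norm hm.aestronglyMeasurable]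
  refine ((h4 m).add (h4 n)).mono' (by exact (hm.norm.pow_const 2).aestronglyMeasurable)
    (Filter.Eventually.of_forall fun z => ?_)
  simp only [norm_mul, RCLike.norm_conj, Pi.add_apply, norm_pow, norm_norm]
  nlinarith [sq_nonneg (‖z m‖ ^ 2 - ‖z n‖ ^ 2), sq_nonneg (‖z m‖ ^ 2 + ‖z n‖ ^ 2)]

/-- The centred quadratic monomial `conj z_m * z_n - δ_mn p_m`. -/
noncomputable def centredMonomial [DecidableEq ι] (q : ι × ι) (z : ι → ℂ) : ℂ :=
  conj (z q.1) * z q.2 - if q.1 = q.2 then (p q.1 : ℂ) else 0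

theorem memLp_centredMonomial [DecidableEq ι] (q : ι × ι) :
    MemLp (centredMonomial p q) 2 (Measure.infinitePi fun i => complexGaussian (p i)) :=
  (memLp_two_conj_mul p q.1 q.2).sub (memLp_const _)

/-- Centring cancels exactly the pairing within each monomial. Only the pairing across the two
survives, which forces `q = r`. -/
theorem integral_centredMonomial_mul_conj [DecidableEq ι] (q r : ι × ι) :
    ∫ z, centredMonomial p q z * conj (centredMonomial p r z)
        ∂Measure.infinitePi (fun i => complexGaussian (p i)) =
      if q = r then (p q.1 * p q.2 : ℂ) else 0 := by
  obtain ⟨m, n⟩ := q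
  obtain ⟨k, l⟩ := r
  have hq := memLp_two_conj_mul p m n
  have hr := (memLp_two_conj_mul p l k)
  set c : ℂ := if m = n then (p m : ℂ) else 0 with hc
  set d : ℂ := if k = l then (p k : ℂ) else 0 with hd
  have hdc : conj d = d := by rw [hd]; split_ifs <;> simp
  have e : ∀ z : ι → ℂ, centredMonomial p (m, n) z * conj (centredMonomial p (k, l) z) =
      conj (z m) * z n * (z k * conj (z l)) - d * (conj (z m) * z n) -
        c * (conj (z l) * z k) + c * d := by
    intro z
    simp only [centredMonomial, ← hc, ← hd, map_sub, map_mul, Complex.conj_conj, hdc]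
    ring
  have i1 : Integrable (fun z : ι → ℂ => conj (z m) * z n * (z k * conj (z l)))
      (Measure.infinitePi fun i => complexGaussian (p i)) := by
    refine (hq.integrable_mul hr).congr (Filter.Eventually.of_forall fun z => ?_)
    simp only [Pi.mul_apply]
    ring
  have i2 := (hq.integrable (by norm_num)).const_mul d
  have i3 := (hr.integrable (by norm_num)).const_mul c
  simp_rw [e]
  have i12 : Integrable (fun z : ι → ℂ => conj (z m) * z n * (z k * conj (z l)) -
      d * (conj (z m) * z n)) (Measure.infinitePi fun i => complexGaussian (p i)) := i1.sub i2
  have i123 : Integrable (fun z : ι → ℂ => conj (z m) * z n * (z k * conj (z l)) -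
      d * (conj (z m) * z n) - c * (conj (z l) * z k))
      (Measure.infinitePi fun i => complexGaussian (p i)) := i12.sub i3
  rw [integral_add i123 (integrable_const _), integral_sub i12 i3, integral_sub i1 i2, integral_const_mul, integral_const_mul, integral_quartic_monomial,
    integral_quadratic_monomial, integral_quadratic_monomial, integral_const]
  simp only [probReal_univ, one_smul, Prod.mk.injEq]
  have hcd : (if m = n ∧ k = l then (p m * p k : ℂ) else 0) = c * d := by
    rw [hc, hd]; split_ifs <;> simp_all
  have hd' : (if l = k then (p l : ℂ) else 0) = d := by
    rw [hd]; by_cases h : k = l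
    · simp [h]
    · simp [h, Ne.symm h]
  rw [hcd, hd', ← hc]
  ring

/-- Second moment of a centred quadratic polynomial in independent complex Gaussian variables. -/
theorem lintegral_sq_norm_sum_centredMonomial [DecidableEq ι] (S : Finset (ι × ι))
    (β : ι × ι → ℂ) :
    ∫⁻ z, ENNReal.ofReal (‖∑ q ∈ S, β q * centredMonomial p q z‖ ^ 2)
        ∂Measure.infinitePi (fun i => complexGaussian (p i)) =
      ENNReal.ofReal (∑ q ∈ S, ‖β q‖ ^ 2 * (p q.1 * p q.2)) := by
  set P := Measure.infinitePi (fun i => complexGaussian (p i)) with hP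
  have hmem : MemLp (fun z => ∑ q ∈ S, β q * centredMonomial p q z) 2 P :=
    memLp_finsetSum S fun q _ => (memLp_centredMonomial p q).const_mul (β q)
  have hint : Integrable (fun z => ‖∑ q ∈ S, β q * centredMonomial p q z‖ ^ 2) P :=
    (memLp_two_iff_integrable_sq_norm hmem.1).mp hmem
  rw [← ofReal_integral_eq_lintegral_ofReal hint
    (Filter.Eventually.of_forall fun z => by positivity)]
  congr 1
  have hC : ((∫ z, ‖∑ q ∈ S, β q * centredMonomial p q z‖ ^ 2 ∂P : ℝ) : ℂ) =
      ((∑ q ∈ S, ‖β q‖ ^ 2 * (p q.1 * p q.2) : ℝ) : ℂ) := by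
    rw [← integral_complex_ofReal]
    have e : ∀ z, ((‖∑ q ∈ S, β q * centredMonomial p q z‖ ^ 2 : ℝ) : ℂ) =
        ∑ q ∈ S, ∑ r ∈ S, β q * conj (β r) *
          (centredMonomial p q z * conj (centredMonomial p r z)) := by
      intro z
      rw [Complex.ofReal_pow, ← Complex.mul_conj', map_sum, Finset.sum_mul_sum]
      refine Finset.sum_congr rfl fun q _ => Finset.sum_congr rfl fun r _ => ?_
      rw [map_mul]
      ring
    have hi : ∀ q r, Integrable (fun z => β q * conj (β r) *
        (centredMonomial p q z * conj (centredMonomial p r z))) P := fun q r =>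
      ((memLp_centredMonomial p q).integrable_mul
        (memLp_centredMonomial p r).star).const_mul _
    simp_rw [e]
    rw [integral_finsetSum _ fun q _ => integrable_finsetSum _ fun r _ => hi q r]
    push_cast
    refine Finset.sum_congr rfl fun q hq => ?_
    rw [integral_finsetSum _ fun r _ => hi q r]
    simp_rw [integral_const_mul]
    simp only [hP, integral_centredMonomial_mul_conj, mul_ite, mul_zero]
    rw [Finset.sum_ite_eq, if_pos hq, Complex.mul_conj']
  exact_mod_cast hC

end Wick

/-! ### Hilbert bases -/

section HilbertBasis

variable {H : Type*} [NormedAddCommGroup H] [InnerProductSpace ℂ H] {ι : Type*}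

/-- Parseval's identity. -/
theorem hasSum_sq_norm_inner (b : HilbertBasis ι ℂ H) (x : H) :
    HasSum (fun i => ‖inner ℂ (b i) x‖ ^ 2) (‖x‖ ^ 2) := by
  have h := b.hasSum_inner_mul_inner x x
  rw [inner_self_eq_norm_sq_to_K] at h
  have e : ∀ i, inner ℂ x (b i) * inner ℂ (b i) x = ((‖inner ℂ (b i) x‖ ^ 2 : ℝ) : ℂ) := by
    intro i
    rw [← inner_conj_symm x (b i), ← Complex.normSq_eq_conj_mul_self, Complex.normSq_eq_norm_sq]
  simp only [e] at h
  refine Complex.hasSum_ofReal.mp ?_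
  rwa [Complex.ofReal_pow]

/-- Distinct basis vectors are at distance `√2`, so the balls of radius `1 / 2` around them are
disjoint. -/
theorem countable_of_hilbertBasis [TopologicalSpace.SeparableSpace H] (b : HilbertBasis ι ℂ H) :
    Countable ι := by
  refine Pairwise.countable_of_isOpen_disjoint (s := fun i => Metric.ball (b i) (1 / 2)) ?_
    (fun _ => Metric.isOpen_ball) (fun i => ⟨b i, Metric.mem_ball_self (by norm_num)⟩)
  intro i j hij
  refine Metric.ball_disjoint_ball ?_
  have h1 : ‖b i‖ = 1 := b.orthonormal.1 i
  have h2 : ‖b j‖ = 1 := b.orthonormal.1 j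
  have h := norm_sub_sq (𝕜 := ℂ) (b i) (b j)
  rw [h1, h2, b.orthonormal.2 hij] at h
  rw [dist_eq_norm]
  simp only [map_zero, mul_zero, sub_zero] at h
  nlinarith [norm_nonneg (b i - b j)]

theorem hasSum_smul_hilbertBasis (b : HilbertBasis ι ℂ H) {z : ι → ℂ}
    (hz : Summable fun i => ‖z i‖ ^ 2) : HasSum (fun i => z i • b i) (∑' i, z i • b i) := by
  have hmem : Memℓp z 2 := by
    refine memℓp_gen ?_
    simpa using hz
  exact (b.hasSum_repr_symm ⟨z, hmem⟩).summable.hasSum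

theorem inner_tsum_smul_hilbertBasis (b : HilbertBasis ι ℂ H) {z : ι → ℂ}
    (hz : Summable fun i => ‖z i‖ ^ 2) (i : ι) : inner ℂ (b i) (∑' j, z j • b j) = z i := by
  classical
  have h := (hasSum_smul_hilbertBasis b hz).mapL (innerSL ℂ (b i))
  have e : ∀ j, innerSL ℂ (b i) (z j • b j) = if j = i then z i else 0 := by
    intro j
    rw [innerSL_apply_apply, inner_smul_right, orthonormal_iff_ite.mp b.orthonormal i j]
    by_cases h : j = i
    · simp [h]
    · simp [h, Ne.symm h]
  simp only [e] at h
  exact h.unique (hasSum_ite_eq i (z i))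

/-- Use `p m * p n ≤ (p m ^ 2 + p n ^ 2) / 2`; the rows and columns of the matrix of `B` have square
sum at most `‖B‖ ^ 2`, by Parseval for `B` and its adjoint. -/
theorem sum_sq_norm_inner_mul_le [CompleteSpace H] (b : HilbertBasis ι ℂ H) (B : H →L[ℂ] H)
    (p : ι → ℝ≥0) (hp : Summable fun i => (p i : ℝ) ^ 2) (F : Finset ι) :
    ∑ q ∈ F ×ˢ F, ‖inner ℂ (b q.1) (B (b q.2))‖ ^ 2 * (p q.1 * p q.2 : ℝ) ≤
      ‖B‖ ^ 2 * ∑' i, (p i : ℝ) ^ 2 := by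
  have hle : ∀ (C : H →L[ℂ] H) (n : ι), ∑ m ∈ F, ‖inner ℂ (b m) (C (b n))‖ ^ 2 ≤ ‖C‖ ^ 2 := by
    intro C n
    refine (sum_le_hasSum F (fun _ _ => by positivity) (hasSum_sq_norm_inner b (C (b n)))).trans ?_
    have := C.le_opNorm (b n)
    rw [b.orthonormal.1 n, mul_one] at this
    gcongr
  have hadj : ∀ m n, ‖inner ℂ (b m) (B (b n))‖ =
      ‖inner ℂ (b n) (ContinuousLinearMap.adjoint B (b m))‖ := fun m n => by
    rw [← ContinuousLinearMap.adjoint_inner_left, norm_inner_symm]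
  have hS : ∑ i ∈ F, (p i : ℝ) ^ 2 ≤ ∑' i, (p i : ℝ) ^ 2 :=
    hp.sum_le_tsum F fun _ _ => by positivity
  have h1 : ∑ m ∈ F, ∑ n ∈ F, ‖inner ℂ (b m) (B (b n))‖ ^ 2 * (p m : ℝ) ^ 2 ≤
      ‖B‖ ^ 2 * ∑ i ∈ F, (p i : ℝ) ^ 2 := by
    rw [Finset.mul_sum]
    refine Finset.sum_le_sum fun m _ => ?_
    rw [← Finset.sum_mul]
    refine mul_le_mul_of_nonneg_right ?_ (by positivity)
    simp_rw [hadj]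
    exact (hle _ m).trans_eq (by rw [LinearIsometryEquiv.norm_map])
  have h2 : ∑ m ∈ F, ∑ n ∈ F, ‖inner ℂ (b m) (B (b n))‖ ^ 2 * (p n : ℝ) ^ 2 ≤
      ‖B‖ ^ 2 * ∑ i ∈ F, (p i : ℝ) ^ 2 := by
    rw [Finset.mul_sum, Finset.sum_comm]
    refine Finset.sum_le_sum fun n _ => ?_
    rw [← Finset.sum_mul]
    exact mul_le_mul_of_nonneg_right (hle B n) (by positivity)
  have h3 : ∑ q ∈ F ×ˢ F, ‖inner ℂ (b q.1) (B (b q.2))‖ ^ 2 * (p q.1 * p q.2 : ℝ) ≤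
      ((∑ m ∈ F, ∑ n ∈ F, ‖inner ℂ (b m) (B (b n))‖ ^ 2 * (p m : ℝ) ^ 2) +
        ∑ m ∈ F, ∑ n ∈ F, ‖inner ℂ (b m) (B (b n))‖ ^ 2 * (p n : ℝ) ^ 2) / 2 := by
    rw [Finset.sum_product, ← Finset.sum_add_distrib, Finset.sum_div]
    refine Finset.sum_le_sum fun m _ => ?_
    rw [← Finset.sum_add_distrib, Finset.sum_div]
    refine Finset.sum_le_sum fun n _ => ?_
    have := two_mul_le_add_sq (p m : ℝ) (p n)
    have h0 := sq_nonneg ‖inner ℂ (b m) (B (b n))‖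
    nlinarith [mul_le_mul_of_nonneg_left this h0]
  have h4 := mul_le_mul_of_nonneg_left hS (sq_nonneg ‖B‖)
  linarith

end HilbertBasis

/-! ### Moments of quadratic forms under the Gaussian measure -/

section Gaussian

variable {H : Type*} [NormedAddCommGroup H] [InnerProductSpace ℂ H]
  {ι : Type*} [Countable ι] {p : ι → ℝ≥0}

/-- The expectation of `∑ |Z_i|²` is `∑ p_i`, which is finite. -/
theorem ae_summable_sq_norm (hp : Summable p) :
    ∀ᵐ z ∂Measure.infinitePi (fun i => complexGaussian (p i)), Summable fun i => ‖z i‖ ^ 2 := by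
  have hm : ∀ i, Measurable fun z : ι → ℂ => ENNReal.ofReal (‖z i‖ ^ 2) := fun i =>
    ((measurable_pi_apply i).norm.pow_const 2).ennreal_ofReal
  have h : ∫⁻ z, ∑' i, ENNReal.ofReal (‖z i‖ ^ 2)
      ∂Measure.infinitePi (fun i => complexGaussian (p i)) ≠ ∞ := by
    rw [lintegral_tsum fun i => (hm i).aemeasurable]
    simp_rw [lintegral_sq_norm_eval_infinitePi]
    exact ENNReal.tsum_coe_ne_top_iff_summable.mpr hp
  filter_upwards [ae_lt_top (Measurable.tsum hm) h] with z hz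
  have := ENNReal.summable_toReal hz.ne
  exact this.congr fun i => ENNReal.toReal_ofReal (by positivity)

variable [MeasurableSpace H] [BorelSpace H] [TopologicalSpace.SeparableSpace H]

/-- Only almost everywhere is the series the limit of its measurable partial sums; where it
diverges, `∑'` takes a default value. -/
theorem aemeasurable_tsum_smul (b : HilbertBasis ι ℂ H) (hp : Summable p) :
    AEMeasurable (fun z : ι → ℂ => ∑' i, z i • b i)
      (Measure.infinitePi fun i => complexGaussian (p i)) := by
  have := UniformSpace.secondCountable_of_separable H
  refine aemeasurable_of_tendsto_metrizable_ae (atTop : Filter (Finset ι))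
    (f := fun F z => ∑ i ∈ F, z i • b i) (fun F => ?_) ?_
  · refine (Finset.measurable_sum F fun i _ => ?_).aemeasurable
    exact (measurable_pi_apply i).smul_const (b i)
  · filter_upwards [ae_summable_sq_norm hp] with z hz
    exact hasSum_smul_hilbertBasis b hz

theorem lintegral_gaussianOfBasis (b : HilbertBasis ι ℂ H) (hp : Summable p) {f : H → ℝ≥0∞}
    (hf : Measurable f) : ∫⁻ ψ, f ψ ∂gaussianOfBasis b p =
      ∫⁻ z, f (∑' i, z i • b i) ∂Measure.infinitePi (fun i => complexGaussian (p i)) :=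
  lintegral_map' hf.aemeasurable (aemeasurable_tsum_smul b hp)

theorem lintegral_sq_norm_gaussianOfBasis (b : HilbertBasis ι ℂ H) (hp : Summable p) :
    ∫⁻ ψ, ENNReal.ofReal (‖ψ‖ ^ 2) ∂gaussianOfBasis b p = ∑' i, (p i : ℝ≥0∞) := by
  rw [lintegral_gaussianOfBasis b hp (by fun_prop)]
  have e : ∀ᵐ z ∂Measure.infinitePi (fun i => complexGaussian (p i)),
      ENNReal.ofReal (‖∑' i, z i • b i‖ ^ 2) = ∑' i, ENNReal.ofReal (‖z i‖ ^ 2) := by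
    filter_upwards [ae_summable_sq_norm hp] with z hz
    have h := hasSum_sq_norm_inner b (∑' i, z i • b i)
    simp only [inner_tsum_smul_hilbertBasis b hz] at h
    rw [← h.tsum_eq, ENNReal.ofReal_tsum_of_nonneg (fun _ => by positivity) hz]
  rw [lintegral_congr_ae e, lintegral_tsum fun i =>
    ((measurable_pi_apply i).norm.pow_const 2).ennreal_ofReal.aemeasurable]
  simp_rw [lintegral_sq_norm_eval_infinitePi]

/-- The variance of the quadratic form of a bounded operator under a Gaussian measure. -/
theorem lintegral_sq_norm_inner_sub_le [CompleteSpace H] (b : HilbertBasis ι ℂ H)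
    (hp : Summable p) (hp2 : Summable fun i => (p i : ℝ) ^ 2) (B : H →L[ℂ] H) {c : ℂ}
    (hc : HasSum (fun n => (p n : ℂ) * inner ℂ (b n) (B (b n))) c) :
    ∫⁻ ψ, ENNReal.ofReal (‖inner ℂ ψ (B ψ) - c‖ ^ 2) ∂gaussianOfBasis b p ≤
      ENNReal.ofReal (‖B‖ ^ 2 * ∑' i, (p i : ℝ) ^ 2) := by
  classical
  have := UniformSpace.secondCountable_of_separable H
  rw [lintegral_gaussianOfBasis b hp (by fun_prop)]
  set P := Measure.infinitePi (fun i => complexGaussian (p i)) with hP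
  set β : ι × ι → ℂ := fun q => inner ℂ (b q.1) (B (b q.2)) with hβ
  -- `X F` is the squared centred form of the truncation of the random vector to the coordinates in
  -- `F`, for which the exact second moment is available.
  set X : Finset ι → (ι → ℂ) → ℝ≥0∞ := fun F z =>
    ENNReal.ofReal (‖∑ q ∈ F ×ˢ F, β q * centredMonomial p q z‖ ^ 2) with hX
  have hXm : ∀ F, AEMeasurable (X F) P := fun F =>
    ((((memLp_finsetSum (F ×ˢ F) fun q _ =>
      (memLp_centredMonomial p q).const_mul (β q)).1.norm).pow 2).aemeasurable).ennreal_ofReal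
  have hXeq : ∀ F z, X F z = ENNReal.ofReal (‖inner ℂ (∑ i ∈ F, z i • b i)
      (B (∑ i ∈ F, z i • b i)) - ∑ n ∈ F, (p n : ℂ) * inner ℂ (b n) (B (b n))‖ ^ 2) := by
    intro F z
    simp only [hX]
    congr 3
    have h1 : inner ℂ (∑ i ∈ F, z i • b i) (B (∑ i ∈ F, z i • b i)) =
        ∑ m ∈ F, ∑ n ∈ F, β (m, n) * (conj (z m) * z n) := by
      rw [map_sum, sum_inner]
      refine Finset.sum_congr rfl fun m _ => ?_
      rw [inner_sum]
      refine Finset.sum_congr rfl fun n _ => ?_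
      rw [map_smul, inner_smul_left, inner_smul_right]
      ring
    have h2 : ∑ n ∈ F, (p n : ℂ) * inner ℂ (b n) (B (b n)) =
        ∑ m ∈ F, ∑ n ∈ F, β (m, n) * (if m = n then (p m : ℂ) else 0) := by
      refine Finset.sum_congr rfl fun m hm => ?_
      simp only [mul_ite, mul_zero]
      rw [Finset.sum_ite_eq, if_pos hm, mul_comm]
    rw [h1, h2, Finset.sum_product, ← Finset.sum_sub_distrib]
    refine Finset.sum_congr rfl fun m _ => ?_
    rw [← Finset.sum_sub_distrib]
    refine Finset.sum_congr rfl fun n _ => ?_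
    rw [centredMonomial, mul_sub]
  have hlim : ∀ᵐ z ∂P, ENNReal.ofReal (‖inner ℂ (∑' i, z i • b i) (B (∑' i, z i • b i)) - c‖ ^ 2) =
      liminf (fun F => X F z) atTop := by
    filter_upwards [ae_summable_sq_norm hp] with z hz
    have ht : Tendsto (fun F : Finset ι => ∑ i ∈ F, z i • b i) atTop (𝓝 (∑' i, z i • b i)) :=
      hasSum_smul_hilbertBasis b hz
    refine (Tendsto.liminf_eq ?_).symm
    simp only [hXeq]
    refine ENNReal.tendsto_ofReal ((Tendsto.norm ?_).pow 2)
    exact (ht.inner ((B.continuous.tendsto _).comp ht)).sub hc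
  -- Fatou's lemma along the finite subsets of `ι`, a countably generated filter because `ι` is
  -- countable. The bound on the truncated moments is uniform in `F`.
  rw [lintegral_congr_ae hlim]
  refine (lintegral_liminf_le' hXm).trans ?_
  refine (liminf_le_liminf (v := fun _ => ENNReal.ofReal (‖B‖ ^ 2 * ∑' i, (p i : ℝ) ^ 2))
    (Eventually.of_forall fun F => ?_)).trans_eq (liminf_const _)
  simp only [hX, hP]
  rw [lintegral_sq_norm_sum_centredMonomial]
  exact ENNReal.ofReal_le_ofReal (sum_sq_norm_inner_mul_le b B p hp2 F)

end Gaussian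

/-! ### Traces in an eigenbasis -/

section Trace

variable {H : Type*} [NormedAddCommGroup H] [InnerProductSpace ℂ H] {ι : Type*}

theorem hasSum_eigenvalues {ρ : H →L[ℂ] H} (hρ : IsDensityMatrix ρ) {w : Set H}
    (b : HilbertBasis w ℂ H) {p : w → ℝ≥0} (hb : ∀ i, ρ (b i) = ((p i : ℝ) : ℂ) • b i) :
    HasSum p 1 := by
  have h := hρ.hasTrace w b
  have e : ∀ i, inner ℂ (b i) (ρ (b i)) = (((p i : ℝ)) : ℂ) := fun i => by
    rw [hb, inner_smul_right, inner_self_eq_norm_sq_to_K, b.orthonormal.1 i]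
    simp
  simp only [e] at h
  have h' : HasSum (fun i => (p i : ℝ)) 1 :=
    Complex.hasSum_ofReal.mp (by rwa [Complex.ofReal_one])
  exact NNReal.hasSum_coe.mp (by rwa [NNReal.coe_one])

theorem summable_sq_of_summable {p : ι → ℝ≥0} (hp : Summable p) :
    Summable fun i => (p i : ℝ) ^ 2 := by
  have h : Summable fun i => (p i : ℝ) := by exact_mod_cast hp
  refine (h.mul_left (∑' i, (p i : ℝ))).of_nonneg_of_le (fun _ => by positivity) fun i => ?_
  rw [sq]
  exact mul_le_mul_of_nonneg_right (h.le_tsum i fun _ _ => by positivity) (by positivity)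

theorem ofReal_sq_norm_eq_tsum (b : HilbertBasis ι ℂ H) (x : H) :
    ENNReal.ofReal (‖x‖ ^ 2) = ∑' k, ENNReal.ofReal (‖inner ℂ (b k) x‖ ^ 2) := by
  have h := hasSum_sq_norm_inner b x
  rw [← h.tsum_eq, ENNReal.ofReal_tsum_of_nonneg (fun _ => by positivity) h.summable]

/-- For symmetric `T`, the sum of `‖T (e i)‖²` does not depend on the orthonormal basis. -/
theorem tsum_sq_norm_apply_eq {κ : Type*} (b : HilbertBasis ι ℂ H) (e : HilbertBasis κ ℂ H)
    {T : H →L[ℂ] H} (hT : T.IsSymmetric) :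
    ∑' i, ENNReal.ofReal (‖T (e i)‖ ^ 2) = ∑' k, ENNReal.ofReal (‖T (b k)‖ ^ 2) := by
  simp_rw [fun i => ofReal_sq_norm_eq_tsum b (T (e i)), fun k => ofReal_sq_norm_eq_tsum e (T (b k))]
  rw [ENNReal.tsum_comm]
  refine tsum_congr fun k => tsum_congr fun i => ?_
  rw [← norm_inner_symm (T (b k)) (e i)]
  congr 3
  exact (hT (b k) (e i)).symm

/-- This moves `tr T²` from the fixed basis to an eigenbasis. The comparison takes place in `ℝ≥0∞`,
so no summability is needed: if the sums diverge, both real sums take the value `0`. -/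
theorem re_opTrace_mul_self [CompleteSpace H] (b : HilbertBasis ι ℂ H) {T : H →L[ℂ] H}
    (hT : T.IsSymmetric) :
    (opTrace (T * T)).re = ∑' k, ‖T (b k)‖ ^ 2 := by
  have e : ∀ i, inner ℂ (onb H i) ((T * T) (onb H i)) = ((‖T (onb H i)‖ ^ 2 : ℝ) : ℂ) := fun i => by
    rw [mul_apply_eq_comp]
    refine (hT _ _).symm.trans ?_
    change inner ℂ (T (onb H i)) (T (onb H i)) = _
    rw [inner_self_eq_norm_sq_to_K]
    simp
  unfold opTrace
  simp_rw [e]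
  rw [← Complex.ofReal_tsum, Complex.ofReal_re]
  have h := congrArg ENNReal.toReal (tsum_sq_norm_apply_eq b (onb H) hT)
  rw [ENNReal.tsum_toReal_eq fun _ => ENNReal.ofReal_ne_top,
    ENNReal.tsum_toReal_eq fun _ => ENNReal.ofReal_ne_top] at h
  simpa only [ENNReal.toReal_ofReal (sq_nonneg _)] using h

end Trace

/-! ### Concentration of quadratic forms under `GAP` -/

section GAP

variable {H : Type*} [NormedAddCommGroup H] [InnerProductSpace ℂ H]

theorem norm_inner_apply_self_le (B : H →L[ℂ] H) (ψ : H) : ‖inner ℂ ψ (B ψ)‖ ≤ ‖B‖ * ‖ψ‖ ^ 2 := by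
  refine (norm_inner_le_norm _ _).trans ?_
  have := mul_le_mul_of_nonneg_left (B.le_opNorm ψ) (norm_nonneg ψ)
  linarith

theorem inner_normalize_apply (B : H →L[ℂ] H) (ψ : H) :
    ‖inner ℂ (((‖ψ‖⁻¹ : ℝ) : ℂ) • ψ) (B (((‖ψ‖⁻¹ : ℝ) : ℂ) • ψ))‖ ^ 2 =
      ‖inner ℂ ψ (B ψ)‖ ^ 2 / ‖ψ‖ ^ 4 := by
  rw [map_smul, inner_smul_left, inner_smul_right, Complex.conj_ofReal, norm_mul, norm_mul,
    Complex.norm_real, norm_inv, norm_norm]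
  ring

/-- For `N ≥ 1 / 2` the first term suffices. For `N ≤ 1 / 2` the quotient is at most `4 * N ≤ 2`,
while `8 * (N - 1) ^ 2 ≥ 2`. -/
theorem sq_div_le_of_le_mul {f N : ℝ} (hN : 0 < N) (hf : 0 ≤ f) (hfN : f ≤ 2 * N) :
    f ^ 2 / N ≤ 2 * f ^ 2 + 8 * (N - 1) ^ 2 := by
  rw [div_le_iff₀ hN]
  rcases le_total (1 / 2) N with h | h
  · nlinarith [sq_nonneg f, sq_nonneg (N - 1), mul_nonneg hN.le (sq_nonneg (N - 1)),
      mul_nonneg (sq_nonneg f) (sub_nonneg.mpr h)]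
  · have h1 : f ^ 2 ≤ (2 * N) ^ 2 := pow_le_pow_left₀ hf hfN 2
    have h2 : 1 / 4 ≤ (N - 1) ^ 2 := by nlinarith
    have h3 : 0 ≤ N * f ^ 2 := by positivity
    have h4 := mul_le_mul_of_nonneg_left h2 hN.le
    nlinarith

variable [CompleteSpace H] [MeasurableSpace H] [BorelSpace H] [TopologicalSpace.SeparableSpace H]

/-- Chebyshev's inequality for the normalized forms, pulled back to `G(ρ)`. The constant is `16 = 2
* 4 + 8`: the forms have second moment at most `4 t`, and `‖ψ‖²` has variance at most `t`.
Finiteness of the measure is recorded for later monotonicity of `Measure.real`. -/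
theorem one_sub_le_GAP_real {ρ : H →L[ℂ] H} (hρ : IsDensityMatrix ρ) {w : Set H}
    (b : HilbertBasis w ℂ H) {p : w → ℝ≥0} (hb : ∀ i, ρ (b i) = ((p i : ℝ) : ℂ) • b i)
    (hG : gaussianMeasure ρ hρ = gaussianOfBasis b p) {κ : Type*} [Fintype κ]
    (B : κ → H →L[ℂ] H) (hB : ∀ k, ‖B k‖ ≤ 2)
    (htr : ∀ k, HasSum (fun n => (p n : ℂ) * inner ℂ (b n) (B k (b n))) 0) {η : ℝ} (hη : 0 < η) :
    1 - 16 * Fintype.card κ * (∑' i, (p i : ℝ) ^ 2) / η ≤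
        (GAP ρ hρ).real {ψ | ∑ k, ‖inner ℂ (ψ : H) (B k ψ)‖ ^ 2 ≤ η} ∧
      IsFiniteMeasure (GAP ρ hρ) := by
  have := UniformSpace.secondCountable_of_separable H
  have hι : Countable w := countable_of_hilbertBasis b
  have hp1 := hasSum_eigenvalues hρ b hb
  have hp := hp1.summable
  have hp2 := summable_sq_of_summable hp
  set t := ∑' i, (p i : ℝ) ^ 2 with ht
  have ht0 : 0 ≤ t := tsum_nonneg fun _ => by positivity
  set G := gaussianOfBasis b p with hGdef
  set N : H → H := fun ψ => ((‖ψ‖⁻¹ : ℝ) : ℂ) • ψ with hN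
  have hNm : Measurable N := by
    have : Measurable fun ψ : H => ((‖ψ‖⁻¹ : ℝ) : ℂ) :=
      Complex.measurable_ofReal.comp measurable_norm.inv
    exact this.smul measurable_id
  have hmass : ∫⁻ ψ, ENNReal.ofReal (‖ψ‖ ^ 2) ∂G = 1 := by
    rw [lintegral_sq_norm_gaussianOfBasis b hp, ← ENNReal.coe_tsum hp, hp1.tsum_eq,
      ENNReal.coe_one]
  have hGA : adjustedGaussian ρ hρ = G.withDensity fun ψ => ENNReal.ofReal (‖ψ‖ ^ 2) := by
    rw [adjustedGaussian, hG]
  have hGAp : IsProbabilityMeasure (adjustedGaussian ρ hρ) := ⟨by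
    rw [hGA, withDensity_apply _ MeasurableSet.univ, Measure.restrict_univ, hmass]⟩
  have hμp : IsProbabilityMeasure ((adjustedGaussian ρ hρ).map N) :=
    Measure.isProbabilityMeasure_map hNm.aemeasurable
  set μ := (adjustedGaussian ρ hρ).map N with hμ
  have hemb : MeasurableEmbedding (Subtype.val : Metric.sphere (0 : H) 1 → H) :=
    MeasurableEmbedding.subtype_coe Metric.isClosed_sphere.measurableSet
  have hGAP : GAP ρ hρ = μ.comap Subtype.val := rfl
  refine ⟨?_, ?_⟩
  swap
  · refine ⟨?_⟩
    rw [hGAP, hemb.comap_apply]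
    exact measure_lt_top _ _
  set A : Set H := {ψ | ψ ∈ Metric.sphere (0 : H) 1 ∧ ∑ k, ‖inner ℂ ψ (B k ψ)‖ ^ 2 ≤ η} with hA
  have hAm : MeasurableSet A := by
    refine Metric.isClosed_sphere.measurableSet.inter
      (IsClosed.measurableSet (s := {ψ : H | ∑ k, ‖inner ℂ ψ (B k ψ)‖ ^ 2 ≤ η}) ?_)
    exact isClosed_le (by fun_prop) continuous_const
  have himg : Subtype.val '' {ψ : Metric.sphere (0 : H) 1 |
      ∑ k, ‖inner ℂ (ψ : H) (B k ψ)‖ ^ 2 ≤ η} = A := by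
    ext ψ
    simp [hA, and_comm]
  have hreal : (GAP ρ hρ).real {ψ | ∑ k, ‖inner ℂ (ψ : H) (B k ψ)‖ ^ 2 ≤ η} = 1 - μ.real Aᶜ := by
    rw [probReal_compl_eq_one_sub hAm, Measure.real, Measure.real, hGAP, hemb.comap_apply, himg]
    ring
  rw [hreal]
  refine sub_le_sub_left ?_ 1
  -- The variance bound applied to the identity operator, whose quadratic form is `‖ψ‖ ^ 2` with
  -- mean `tr ρ = 1`.
  have hY : ∫⁻ ψ, ENNReal.ofReal ((‖ψ‖ ^ 2 - 1) ^ 2) ∂G ≤ ENNReal.ofReal t := by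
    have hc : HasSum (fun n => (p n : ℂ) * inner ℂ (b n) ((1 : H →L[ℂ] H) (b n))) 1 := by
      have e : ∀ n, (p n : ℂ) * inner ℂ (b n) ((1 : H →L[ℂ] H) (b n)) = (((p n : ℝ)) : ℂ) := by
        intro n
        rw [one_apply_eq_self, inner_self_eq_norm_sq_to_K, b.orthonormal.1 n]
        simp
      simp only [e]
      have : HasSum (fun i => (p i : ℝ)) 1 := NNReal.hasSum_coe.mpr hp1
      simpa using Complex.hasSum_ofReal.mpr this
    have h := lintegral_sq_norm_inner_sub_le b hp hp2 (1 : H →L[ℂ] H) hc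
    refine le_trans (le_of_eq ?_) (h.trans (ENNReal.ofReal_le_ofReal ?_))
    · refine lintegral_congr fun ψ => ?_
      rw [one_apply_eq_self, inner_self_eq_norm_sq_to_K]
      congr 1
      have : ((‖ψ‖ : ℂ) ^ 2 - 1) = ((‖ψ‖ ^ 2 - 1 : ℝ) : ℂ) := by push_cast; rfl
      refine Eq.trans ?_ (congrArg (fun x : ℂ => ‖x‖ ^ 2) this).symm
      rw [Complex.norm_real, Real.norm_eq_abs, sq_abs]
    · have h1 : ‖(1 : H →L[ℂ] H)‖ ^ 2 ≤ 1 :=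
        pow_le_one₀ (norm_nonneg _) ContinuousLinearMap.norm_id_le
      nlinarith
  have hX : ∀ k, ∫⁻ ψ, ENNReal.ofReal (‖inner ℂ ψ (B k ψ)‖ ^ 2) ∂G ≤ ENNReal.ofReal (4 * t) := by
    intro k
    have h := lintegral_sq_norm_inner_sub_le b hp hp2 (B k) (htr k)
    simp only [sub_zero] at h
    refine h.trans (ENNReal.ofReal_le_ofReal (mul_le_mul_of_nonneg_right ?_ ht0))
    have := pow_le_pow_left₀ (norm_nonneg _) (hB k) 2
    linarith
  have hpt : ∀ ψ ∈ N ⁻¹' Aᶜ, ENNReal.ofReal (‖ψ‖ ^ 2) ≤ ENNReal.ofReal η⁻¹ *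
      ∑ k, (ENNReal.ofReal 2 * ENNReal.ofReal (‖inner ℂ ψ (B k ψ)‖ ^ 2) +
        ENNReal.ofReal 8 * ENNReal.ofReal ((‖ψ‖ ^ 2 - 1) ^ 2)) := by
    intro ψ hψ
    -- The zero vector is sent to `0`, off the sphere and hence into `Aᶜ`, but its weight `‖ψ‖ ^ 2`
    -- vanishes.
    rcases eq_or_ne ψ 0 with rfl | h0
    · simp
    have hpos : 0 < ‖ψ‖ := norm_pos_iff.mpr h0
    have hsph : N ψ ∈ Metric.sphere (0 : H) 1 := by
      rw [mem_sphere_zero_iff_norm, hN, norm_smul, Complex.norm_real, norm_inv, norm_norm,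
        inv_mul_cancel₀ hpos.ne']
    have hlt : η < ∑ k, ‖inner ℂ (N ψ) (B k (N ψ))‖ ^ 2 := by
      by_contra hle
      exact hψ ⟨hsph, not_lt.mp hle⟩
    simp only [hN, inner_normalize_apply] at hlt
    have e : ∀ k, ENNReal.ofReal 2 * ENNReal.ofReal (‖inner ℂ ψ (B k ψ)‖ ^ 2) +
        ENNReal.ofReal 8 * ENNReal.ofReal ((‖ψ‖ ^ 2 - 1) ^ 2) =
        ENNReal.ofReal (2 * ‖inner ℂ ψ (B k ψ)‖ ^ 2 + 8 * (‖ψ‖ ^ 2 - 1) ^ 2) := fun k => by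
      rw [ENNReal.ofReal_add (by positivity) (by positivity), ENNReal.ofReal_mul (by norm_num),
        ENNReal.ofReal_mul (by norm_num)]
    simp_rw [e]
    rw [← ENNReal.ofReal_sum_of_nonneg fun _ _ => by positivity,
      ← ENNReal.ofReal_mul (by positivity)]
    refine ENNReal.ofReal_le_ofReal ?_
    rw [← div_eq_inv_mul, le_div_iff₀ hη]
    calc ‖ψ‖ ^ 2 * η ≤ ‖ψ‖ ^ 2 * ∑ k, ‖inner ℂ ψ (B k ψ)‖ ^ 2 / ‖ψ‖ ^ 4 := by gcongr
      _ = ∑ k, ‖inner ℂ ψ (B k ψ)‖ ^ 2 / ‖ψ‖ ^ 2 := by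
        rw [Finset.mul_sum]
        refine Finset.sum_congr rfl fun k _ => ?_
        field_simp
      _ ≤ _ := Finset.sum_le_sum fun k _ => sq_div_le_of_le_mul (by positivity) (norm_nonneg _)
        ((norm_inner_apply_self_le (B k) ψ).trans
          (mul_le_mul_of_nonneg_right (hB k) (by positivity)))
  have hbound : μ Aᶜ ≤ ENNReal.ofReal (16 * Fintype.card κ * t / η) := by
    rw [hμ, Measure.map_apply hNm hAm.compl, hGA, withDensity_apply _ (hNm hAm.compl)]
    have hfm : ∀ k, Measurable fun ψ : H =>
        ENNReal.ofReal 2 * ENNReal.ofReal (‖inner ℂ ψ (B k ψ)‖ ^ 2) := fun k =>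
      (Continuous.measurable (f := fun ψ : H => ‖inner ℂ ψ (B k ψ)‖ ^ 2)
        (by fun_prop)).ennreal_ofReal.const_mul _
    have hfm' : Measurable fun ψ : H => ENNReal.ofReal ((‖ψ‖ ^ 2 - 1) ^ 2) := by fun_prop
    calc ∫⁻ ψ in N ⁻¹' Aᶜ, ENNReal.ofReal (‖ψ‖ ^ 2) ∂G
        ≤ ∫⁻ ψ in N ⁻¹' Aᶜ, ENNReal.ofReal η⁻¹ *
          ∑ k, (ENNReal.ofReal 2 * ENNReal.ofReal (‖inner ℂ ψ (B k ψ)‖ ^ 2) +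
            ENNReal.ofReal 8 * ENNReal.ofReal ((‖ψ‖ ^ 2 - 1) ^ 2)) ∂G :=
          setLIntegral_mono' (hNm hAm.compl) hpt
      _ ≤ ∫⁻ ψ, ENNReal.ofReal η⁻¹ *
          ∑ k, (ENNReal.ofReal 2 * ENNReal.ofReal (‖inner ℂ ψ (B k ψ)‖ ^ 2) +
            ENNReal.ofReal 8 * ENNReal.ofReal ((‖ψ‖ ^ 2 - 1) ^ 2)) ∂G := setLIntegral_le_lintegral _ _
      _ = ENNReal.ofReal η⁻¹ *
          ∑ k, (ENNReal.ofReal 2 * ∫⁻ ψ, ENNReal.ofReal (‖inner ℂ ψ (B k ψ)‖ ^ 2) ∂G +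
            ENNReal.ofReal 8 * ∫⁻ ψ, ENNReal.ofReal ((‖ψ‖ ^ 2 - 1) ^ 2) ∂G) := by
        rw [lintegral_const_mul' _ _ ENNReal.ofReal_ne_top, lintegral_finsetSum _ fun k _ => by
          exact (hfm k).add (hfm'.const_mul _)]
        congr 1
        refine Finset.sum_congr rfl fun k _ => ?_
        rw [lintegral_add_left (hfm k), lintegral_const_mul' _ _ ENNReal.ofReal_ne_top,
          lintegral_const_mul' _ _ ENNReal.ofReal_ne_top]
      _ ≤ ENNReal.ofReal η⁻¹ * ∑ _k : κ, (ENNReal.ofReal 2 * ENNReal.ofReal (4 * t) +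
            ENNReal.ofReal 8 * ENNReal.ofReal t) := by
        gcongr with k
        · exact hX k
      _ = ENNReal.ofReal (16 * Fintype.card κ * t / η) := by
        rw [Finset.sum_const, ← ENNReal.ofReal_mul (by norm_num),
          ← ENNReal.ofReal_mul (by norm_num), ← ENNReal.ofReal_add (by positivity) (by positivity),
          ← ENNReal.ofReal_nsmul, ← ENNReal.ofReal_mul (by positivity), Finset.card_univ,
          nsmul_eq_mul]
        congr 1
        ring
  exact ENNReal.toReal_le_of_le_ofReal (by positivity) hbound

end GAP

/-! ### Operators on a finite-dimensional space in an orthonormal basis -/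

section FiniteDimensional

variable {H : Type*} [NormedAddCommGroup H] [InnerProductSpace ℂ H] {I : Type*} [Fintype I]

theorem sum_inner_smul_hilbertBasis (e : HilbertBasis I ℂ H) (x : H) :
    ∑ i, inner ℂ (e i) x • e i = x := by
  have h := (e.hasSum_repr x).unique (hasSum_fintype _)
  simp only [e.repr_apply_apply] at h
  exact h.symm

theorem sum_sq_norm_inner_hilbertBasis (e : HilbertBasis I ℂ H) (x : H) :
    ∑ i, ‖inner ℂ (e i) x‖ ^ 2 = ‖x‖ ^ 2 :=
  (hasSum_fintype _).unique (hasSum_sq_norm_inner e x)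

/-- In finite dimension, convergence of all matrix elements gives summability in operator norm.
Hence the operator-valued `∑'` is a genuine sum. -/
theorem inner_tsum_apply {α : Type*} (e : HilbertBasis I ℂ H) (S : α → H →L[ℂ] H) (L : I → I → ℂ)
    (hS : ∀ i j, HasSum (fun n => inner ℂ (e i) (S n (e j))) (L i j)) (i j : I) :
    inner ℂ (e i) ((∑' n, S n) (e j)) = L i j := by
  have hexp : ∀ M : H →L[ℂ] H,
      M = ∑ i, ∑ j, inner ℂ (e i) (M (e j)) • InnerProductSpace.rankOne ℂ (e i) (e j) := by
    intro M
    ext x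
    simp only [sum_apply, smul_apply, InnerProductSpace.rankOne_apply]
    conv_lhs => rw [← sum_inner_smul_hilbertBasis e x, map_sum]
    rw [Finset.sum_comm]
    refine Finset.sum_congr rfl fun j _ => ?_
    conv_lhs => rw [map_smul, ← sum_inner_smul_hilbertBasis e (M (e j)), Finset.smul_sum]
    refine Finset.sum_congr rfl fun i _ => ?_
    rw [smul_smul, smul_smul, mul_comm]
  have hsum : Summable S := by
    have h : Summable fun n => ∑ i, ∑ j,
        inner ℂ (e i) (S n (e j)) • InnerProductSpace.rankOne ℂ (e i) (e j) :=
      summable_sum fun i _ => summable_sum fun j _ => (hS i j).summable.smul_const _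
    exact h.congr fun n => (hexp (S n)).symm
  have h := ((hsum.hasSum.mapL (ContinuousLinearMap.apply ℂ H (e j))).mapL (innerSL ℂ (e i)))
  exact h.unique (hS i j)

/-- `|M|` and `M` have the same norm on every vector, hence the same Hilbert–Schmidt norm. The trace
of `|M|` is at most `∑ ‖|M| e_i‖`, to which Cauchy–Schwarz applies. -/
theorem traceNorm_le_sqrt [CompleteSpace H] [Fintype (onbIndex H)] (M : H →L[ℂ] H) :
    traceNorm M ≤ √(Fintype.card (onbIndex H) *
      ∑ q : onbIndex H × onbIndex H, ‖inner ℂ (onb H q.1) (M (onb H q.2))‖ ^ 2) := by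
  set S := CFC.sqrt (star M * M) with hS
  have hpos : S.IsPositive :=
    (ContinuousLinearMap.nonneg_iff_isPositive _).mp (CFC.sqrt_nonneg _)
  have hSS : S * S = star M * M := CFC.sqrt_mul_sqrt_self _ (star_mul_self_nonneg M)
  have hnorm : ∀ x, ‖S x‖ ^ 2 = ‖M x‖ ^ 2 := by
    intro x
    have h1 : inner ℂ (S x) (S x) = inner ℂ (M x) (M x) := by
      calc inner ℂ (S x) (S x) = inner ℂ x ((S * S) x) := hpos.isSymmetric _ _
        _ = inner ℂ (M x) (M x) := by
          rw [hSS, mul_apply_eq_comp, ContinuousLinearMap.star_eq_adjoint,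
            ContinuousLinearMap.adjoint_inner_right]
    rw [← inner_self_eq_norm_sq (𝕜 := ℂ), ← inner_self_eq_norm_sq (𝕜 := ℂ), h1]
  have hsum : ∑ q : onbIndex H × onbIndex H, ‖inner ℂ (onb H q.1) (M (onb H q.2))‖ ^ 2 =
      ∑ i, ‖S (onb H i)‖ ^ 2 := by
    rw [Fintype.sum_prod_type_right]
    refine Finset.sum_congr rfl fun i _ => ?_
    exact (sum_sq_norm_inner_hilbertBasis (onb H) (M (onb H i))).trans (hnorm _).symm
  rw [hsum]
  refine Real.le_sqrt_of_sq_le ?_ |>.trans' ?_ (b := ∑ i, ‖S (onb H i)‖)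
  · exact sq_sum_le_card_mul_sum_sq
  · unfold traceNorm opTrace
    rw [tsum_fintype, Complex.re_sum]
    refine Finset.sum_le_sum fun i _ => ?_
    refine (Complex.re_le_norm _).trans ((norm_inner_le_norm _ _).trans ?_)
    rw [(onb H).orthonormal.1 i, one_mul]

theorem card_eq_finrank (e : HilbertBasis I ℂ H) : Fintype.card I = Module.finrank ℂ H :=
  (Module.finrank_eq_card_basis e.toOrthonormalBasis.toBasis).symm

end FiniteDimensional

/-! ### The Hilbert space tensor product and partial traces -/

section Bipartite

variable {Ha : Type*} {Hb : Type*} [NormedAddCommGroup Ha] [InnerProductSpace ℂ Ha]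
  [NormedAddCommGroup Hb] [InnerProductSpace ℂ Hb]

/-- For `x : Ha`, the bounded operator `y ↦ x ⊗ y` from `Hb` to `Ha ⊗ Hb`. -/
noncomputable def tensorLeft (Hb : Type*) [NormedAddCommGroup Hb] [InnerProductSpace ℂ Hb]
    (x : Ha) : Hb →L[ℂ] HilbertTensor Ha Hb :=
  (UniformSpace.Completion.toComplL : Ha ⊗[ℂ] Hb →L[ℂ] HilbertTensor Ha Hb) ∘L
    TensorProduct.mkL ℂ Ha Hb x

theorem tensorLeft_apply (x : Ha) (y : Hb) :
    tensorLeft Hb x y = ((x ⊗ₜ[ℂ] y : Ha ⊗[ℂ] Hb) : HilbertTensor Ha Hb) := rfl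

theorem tensorRight_apply (x : Ha) (y : Hb) : tensorRight Ha y x = tensorLeft Hb x y := rfl

theorem norm_tensorLeft_le (x : Ha) : ‖tensorLeft Hb x‖ ≤ ‖x‖ :=
  ContinuousLinearMap.opNorm_le_bound _ (norm_nonneg _) fun y => by
    rw [tensorLeft_apply, UniformSpace.Completion.norm_coe, TensorProduct.norm_tmul]

/-- A finite power of `Hb` maps continuously onto the algebraic tensor product, which is dense in
its completion. -/
theorem separableSpace_hilbertTensor [CompleteSpace Ha] [FiniteDimensional ℂ Ha]
    [TopologicalSpace.SeparableSpace Hb] :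
    TopologicalSpace.SeparableSpace (HilbertTensor Ha Hb) := by
  let e := stdOrthonormalBasis ℂ Ha
  let f : (Fin (Module.finrank ℂ Ha) → Hb) →ₗ[ℂ] Ha ⊗[ℂ] Hb :=
    ∑ i, (TensorProduct.mk ℂ Ha Hb (e i)) ∘ₗ LinearMap.proj i
  have hf : Function.Surjective f := by
    rw [← LinearMap.range_eq_top, eq_top_iff]
    rintro t -
    induction t using TensorProduct.induction_on with
    | zero => exact zero_mem _
    | tmul x y =>
      refine ⟨fun i => inner ℂ (e i) x • y, ?_⟩
      simp only [f, LinearMap.sum_apply, LinearMap.comp_apply, LinearMap.proj_apply,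
        TensorProduct.mk_apply]
      conv_rhs => rw [← e.sum_repr' x, TensorProduct.sum_tmul]
      refine Finset.sum_congr rfl fun i _ => ?_
      rw [TensorProduct.tmul_smul, TensorProduct.smul_tmul']
    | add s t hs ht => exact add_mem hs ht
  have hcont : Continuous fun y : Fin (Module.finrank ℂ Ha) → Hb =>
      ((f y : Ha ⊗[ℂ] Hb) : HilbertTensor Ha Hb) := by
    have : (fun y : Fin (Module.finrank ℂ Ha) → Hb =>
        ((f y : Ha ⊗[ℂ] Hb) : HilbertTensor Ha Hb)) = fun y => ∑ i, tensorLeft Hb (e i) (y i) := by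
      funext y
      simp only [f, LinearMap.sum_apply]
      exact map_sum (UniformSpace.Completion.toComplL : Ha ⊗[ℂ] Hb →L[ℂ] HilbertTensor Ha Hb) _ _
    rw [this]
    fun_prop
  exact ((UniformSpace.Completion.denseRange_coe.comp hf.denseRange
    (UniformSpace.Completion.continuous_coe _))).separableSpace hcont

variable [CompleteSpace Hb]

/-- The operator `|x⟩⟨x'| ⊗ 1` on `Ha ⊗ Hb`. -/
noncomputable def rankOneTensorOne (Hb : Type*) [NormedAddCommGroup Hb] [InnerProductSpace ℂ Hb]
    [CompleteSpace Hb] (x x' : Ha) : HilbertTensor Ha Hb →L[ℂ] HilbertTensor Ha Hb :=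
  tensorLeft Hb x ∘L ContinuousLinearMap.adjoint (tensorLeft Hb x')

theorem norm_rankOneTensorOne_le (x x' : Ha) : ‖rankOneTensorOne Hb x x'‖ ≤ ‖x‖ * ‖x'‖ := by
  refine (ContinuousLinearMap.opNorm_comp_le _ _).trans ?_
  rw [LinearIsometryEquiv.norm_map]
  exact mul_le_mul (norm_tensorLeft_le x) (norm_tensorLeft_le x') (norm_nonneg _) (norm_nonneg _)

theorem hasSum_inner_rankOneTensorOne {ι : Type*} (f : HilbertBasis ι ℂ Hb) (x x' : Ha)
    (φ ψ : HilbertTensor Ha Hb) :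
    HasSum (fun n => inner ℂ φ (tensorLeft Hb x (f n)) * inner ℂ (tensorLeft Hb x' (f n)) ψ)
      (inner ℂ φ (rankOneTensorOne Hb x x' ψ)) := by
  have h := f.hasSum_inner_mul_inner (ContinuousLinearMap.adjoint (tensorLeft Hb x) φ)
    (ContinuousLinearMap.adjoint (tensorLeft Hb x') ψ)
  rw [ContinuousLinearMap.adjoint_inner_left] at h
  simp only [ContinuousLinearMap.adjoint_inner_left, ContinuousLinearMap.adjoint_inner_right] at h
  exact h

theorem hasSum_sq_norm_inner_tensorLeft {ι : Type*} (f : HilbertBasis ι ℂ Hb) (x : Ha)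
    (ψ : HilbertTensor Ha Hb) :
    HasSum (fun n => ‖inner ℂ (tensorLeft Hb x (f n)) ψ‖ ^ 2)
      (‖ContinuousLinearMap.adjoint (tensorLeft Hb x) ψ‖ ^ 2) := by
  have h := hasSum_sq_norm_inner f (ContinuousLinearMap.adjoint (tensorLeft Hb x) ψ)
  simpa only [ContinuousLinearMap.adjoint_inner_right] using h

/-- Absolute summability, needed to interchange the sum over the eigenbasis with that of the partial
trace. The product of inner products is dominated by a sum of squares, whose sum over the basis of
`Hb` is at most `‖x‖ ^ 2 + ‖x'‖ ^ 2`. -/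
theorem summable_eigen_mul_inner_tensorLeft {ι κ : Type*} (f : HilbertBasis κ ℂ Hb)
    (b : HilbertBasis ι ℂ (HilbertTensor Ha Hb)) {p : ι → ℝ≥0} (hp : Summable p) (x x' : Ha) :
    Summable fun q : ι × κ => (p q.1 : ℂ) *
      (inner ℂ (b q.1) (tensorLeft Hb x' (f q.2)) * inner ℂ (tensorLeft Hb x (f q.2)) (b q.1)) := by
  have hp' : Summable fun i => (p i : ℝ) := NNReal.summable_coe.mpr hp
  set u : Ha → ι → κ → ℝ := fun x k n => ‖inner ℂ (tensorLeft Hb x (f n)) (b k)‖ ^ 2 with hu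
  have hle : ∀ x k, ‖ContinuousLinearMap.adjoint (tensorLeft Hb x) (b k)‖ ^ 2 ≤ ‖x‖ ^ 2 := by
    intro x k
    refine pow_le_pow_left₀ (norm_nonneg _) ?_ 2
    refine (ContinuousLinearMap.le_opNorm _ _).trans ?_
    rw [b.orthonormal.1 k, mul_one, LinearIsometryEquiv.norm_map]
    exact norm_tensorLeft_le x
  have hs : ∀ k, HasSum (fun n => (p k : ℝ) * (u x k n + u x' k n))
      (p k * (‖ContinuousLinearMap.adjoint (tensorLeft Hb x) (b k)‖ ^ 2 +
        ‖ContinuousLinearMap.adjoint (tensorLeft Hb x') (b k)‖ ^ 2)) := fun k =>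
    ((hasSum_sq_norm_inner_tensorLeft f x (b k)).add
      (hasSum_sq_norm_inner_tensorLeft f x' (b k))).mul_left _
  have hbig : Summable fun q : ι × κ => (p q.1 : ℝ) * (u x q.1 q.2 + u x' q.1 q.2) := by
    rw [summable_prod_of_nonneg fun q => by simp only [hu, Pi.zero_apply]; positivity]
    refine ⟨fun k => (hs k).summable, ?_⟩
    simp_rw [fun k => (hs k).tsum_eq]
    refine (hp'.mul_right (‖x‖ ^ 2 + ‖x'‖ ^ 2)).of_nonneg_of_le (fun k => by positivity) fun k => ?_
    exact mul_le_mul_of_nonneg_left (add_le_add (hle x k) (hle x' k)) (by positivity)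
  refine Summable.of_norm_bounded hbig fun q => ?_
  rw [norm_mul, norm_mul, norm_inner_symm (b q.1)]
  have h1 : ‖(p q.1 : ℂ)‖ = (p q.1 : ℝ) := by simp
  rw [h1]
  refine mul_le_mul_of_nonneg_left ?_ (by positivity)
  have := two_mul_le_add_sq ‖inner ℂ (tensorLeft Hb x' (f q.2)) (b q.1)‖
    ‖inner ℂ (tensorLeft Hb x (f q.2)) (b q.1)‖
  simp only [hu]
  nlinarith [norm_nonneg (inner ℂ (tensorLeft Hb x' (f q.2)) (b q.1)),
    norm_nonneg (inner ℂ (tensorLeft Hb x (f q.2)) (b q.1))]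

/-- The matrix elements of the partial trace `tr_b ρ` as traces `tr ((|x'⟩⟨x| ⊗ 1) ρ)`. -/
theorem hasSum_inner_partialTrace_summand {ι κ : Type*} (f : HilbertBasis κ ℂ Hb)
    {ρ : HilbertTensor Ha Hb →L[ℂ] HilbertTensor Ha Hb} (hρ : ρ.IsSymmetric)
    (b : HilbertBasis ι ℂ (HilbertTensor Ha Hb)) {p : ι → ℝ≥0} (hp : Summable p)
    (hb : ∀ i, ρ (b i) = ((p i : ℝ) : ℂ) • b i) (x x' : Ha) :
    ∃ a : ℂ, HasSum (fun k => (p k : ℂ) * inner ℂ (b k) (rankOneTensorOne Hb x' x (b k))) a ∧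
      HasSum (fun n => inner ℂ (tensorLeft Hb x (f n)) (ρ (tensorLeft Hb x' (f n)))) a := by
  have hs := summable_eigen_mul_inner_tensorLeft f b hp x x'
  -- Both series are iterated sums of the same absolutely summable double family: summing over `Hb`
  -- first gives the trace, over the eigenbasis first the partial trace.
  refine ⟨_, hs.hasSum.prod_fiberwise fun k =>
    (hasSum_inner_rankOneTensorOne f x' x (b k) (b k)).mul_left _, ?_⟩
  refine ((Equiv.prodComm κ ι).hasSum_iff.mpr hs.hasSum).prod_fiberwise fun n => ?_
  have h := b.hasSum_inner_mul_inner (tensorLeft Hb x (f n)) (ρ (tensorLeft Hb x' (f n)))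
  refine h.congr_fun fun k => ?_
  have e : inner ℂ (b k) (ρ (tensorLeft Hb x' (f n))) =
      (p k : ℂ) * inner ℂ (b k) (tensorLeft Hb x' (f n)) := by
    refine (hρ (b k) (tensorLeft Hb x' (f n))).symm.trans ?_
    change inner ℂ (ρ (b k)) _ = _
    rw [hb, inner_smul_left, Complex.conj_ofReal]
  rw [e]
  simp only [Function.comp_apply, Equiv.prodComm_apply, Prod.swap_prod_mk]
  ring

end Bipartite

/-! ### Matrix elements of partial traces and of the reduced state -/

section

variable {Ha : Type*} {Hb : Type*} [NormedAddCommGroup Ha] [InnerProductSpace ℂ Ha]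
  [NormedAddCommGroup Hb] [InnerProductSpace ℂ Hb] [CompleteSpace Ha] [CompleteSpace Hb]

theorem inner_partialTrace_eq [Fintype (onbIndex Ha)]
    {T : HilbertTensor Ha Hb →L[ℂ] HilbertTensor Ha Hb} {L : onbIndex Ha → onbIndex Ha → ℂ}
    (h : ∀ i j, HasSum (fun n => inner ℂ (tensorLeft Hb (onb Ha i) (onb Hb n))
      (T (tensorLeft Hb (onb Ha j) (onb Hb n)))) (L i j)) (i j : onbIndex Ha) :
    inner ℂ (onb Ha i) (partialTrace T (onb Ha j)) = L i j := by
  refine inner_tsum_apply (onb Ha) _ L (fun i j => ?_) i j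
  refine (h i j).congr_fun fun n => ?_
  simp only [ContinuousLinearMap.comp_apply, ContinuousLinearMap.adjoint_inner_right,
    tensorRight_apply]

theorem inner_reducedDensity [Fintype (onbIndex Ha)] (ψ : HilbertTensor Ha Hb)
    (i j : onbIndex Ha) :
    inner ℂ (onb Ha i) (reducedDensity ψ (onb Ha j)) =
      inner ℂ ψ (rankOneTensorOne Hb (onb Ha j) (onb Ha i) ψ) := by
  refine inner_partialTrace_eq
    (L := fun i j => inner ℂ ψ (rankOneTensorOne Hb (onb Ha j) (onb Ha i) ψ)) (fun i j => ?_) i j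
  refine (hasSum_inner_rankOneTensorOne (onb Hb) _ _ ψ ψ).congr_fun fun n => ?_
  rw [InnerProductSpace.rankOne_apply, inner_smul_right]

end

theorem norm_sub_smul_one_le {H : Type*} [NormedAddCommGroup H] [InnerProductSpace ℂ H]
    (A : H →L[ℂ] H) (a : ℂ) : ‖A - a • (1 : H →L[ℂ] H)‖ ≤ ‖A‖ + ‖a‖ := by
  refine (norm_sub_le _ _).trans (add_le_add le_rfl ?_)
  rw [norm_smul]
  exact mul_le_of_le_one_right (norm_nonneg _) ContinuousLinearMap.norm_id_le

/-- Names the eigenbasis chosen inside the definition of `G(ρ)`; the argument works for any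
eigenbasis, so nothing more about the choice is needed. -/
theorem exists_gaussianMeasure_eq {H : Type*} [NormedAddCommGroup H] [InnerProductSpace ℂ H]
    [CompleteSpace H] [MeasurableSpace H] {ρ : H →L[ℂ] H} (hρ : IsDensityMatrix ρ) :
    ∃ (w : Set H) (b : HilbertBasis w ℂ H) (p : w → ℝ≥0),
      (∀ i, ρ (b i) = ((p i : ℝ) : ℂ) • b i) ∧ gaussianMeasure ρ hρ = gaussianOfBasis b p :=
  ⟨_, _, _, hρ.exists_eigenbasis.choose_spec.choose_spec.choose_spec, rfl⟩

end QuantumTypicality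

/-! ### The typicality bound -/

theorem theorem3
    {Ha : Type*} [NormedAddCommGroup Ha] [InnerProductSpace ℂ Ha] [CompleteSpace Ha]
    [FiniteDimensional ℂ Ha]
    {Hb : Type*} [NormedAddCommGroup Hb] [InnerProductSpace ℂ Hb] [CompleteSpace Hb]
    [TopologicalSpace.SeparableSpace Hb]
    (ρ : QuantumTypicality.HilbertTensor Ha Hb →L[ℂ] QuantumTypicality.HilbertTensor Ha Hb)
    (hρ : QuantumTypicality.IsDensityMatrix ρ) (hnorm : ‖ρ‖ < 1 / 4)
    (δ : ℝ) (hδ : 0 < δ) :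
    1 - δ ≤ (QuantumTypicality.GAP ρ hρ).real
      {ψ : Metric.sphere (0 : QuantumTypicality.HilbertTensor Ha Hb) 1 |
        QuantumTypicality.traceNorm
            (QuantumTypicality.reducedDensity (ψ : QuantumTypicality.HilbertTensor Ha Hb) -
              QuantumTypicality.partialTrace ρ) ≤
          √(28 * (Module.finrank ℂ Ha : ℝ) ^ 5 * (QuantumTypicality.opTrace (ρ * ρ)).re / δ)} := by
  open QuantumTypicality in
  have hsep : TopologicalSpace.SeparableSpace (HilbertTensor Ha Hb) := separableSpace_hilbertTensor
  obtain ⟨w, b, p, hb, hG⟩ := exists_gaussianMeasure_eq hρ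
  have hsymm : ρ.IsSymmetric := hρ.isPositive.isSymmetric
  have hp1 := hasSum_eigenvalues hρ b hb
  have hp2 := summable_sq_of_summable hp1.summable
  have hp1' : HasSum (fun i => (p i : ℝ)) 1 := NNReal.hasSum_coe.mpr hp1
  have ht : (opTrace (ρ * ρ)).re = ∑' i, (p i : ℝ) ^ 2 := by
    rw [re_opTrace_mul_self b hsymm]
    refine tsum_congr fun i => ?_
    rw [hb, norm_smul, b.orthonormal.1 i, Complex.norm_real, mul_one, Real.norm_eq_abs, sq_abs]
  have hwne : ∃ i, p i ≠ 0 := by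
    by_contra! h
    exact one_ne_zero (hp1.unique (hasSum_zero.congr_fun h))
  obtain ⟨i₀, hi₀⟩ := hwne
  rw [ht]
  set t := ∑' i, (p i : ℝ) ^ 2 with htdef
  have htpos : 0 < t := hp2.tsum_pos (fun _ => by positivity) i₀ (by positivity)
  have hfin : Finite (onbIndex Ha) := (onb Ha).orthonormal.linearIndependent.finite
  let _ : Fintype (onbIndex Ha) := Fintype.ofFinite _
  have hcard : Fintype.card (onbIndex Ha) = Module.finrank ℂ Ha := card_eq_finrank (onb Ha)
  -- If `Ha` were trivial, so would be the tensor product, which contains a unit vector. The bound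
  -- is needed for `d ^ 2 ≤ d ^ 4`.
  have hd : 1 ≤ Module.finrank ℂ Ha := by
    by_contra! h0
    have hsub : Subsingleton Ha := Module.finrank_zero_iff.mp (Nat.lt_one_iff.mp h0)
    have hH : ∀ x : HilbertTensor Ha Hb, x = 0 := fun x =>
      UniformSpace.Completion.induction_on x (isClosed_eq continuous_id continuous_const)
        fun y => by rw [Subsingleton.elim y 0, UniformSpace.Completion.coe_zero]
    have := b.orthonormal.1 i₀
    rw [hH (b i₀), norm_zero] at this
    exact zero_ne_one this
  set d : ℝ := (Module.finrank ℂ Ha : ℝ) with hddef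
  have hd1 : (1 : ℝ) ≤ d := by rw [hddef]; exact_mod_cast hd
  -- `a i j` is an entry of `tr_b ρ` (`ha2`) and also the `G(ρ)`-mean of the form of `A i j`, as a
  -- sum over the eigenbasis (`ha1`).
  choose a ha1 ha2 using fun i j : onbIndex Ha =>
    hasSum_inner_partialTrace_summand (onb Hb) hsymm b hp1.summable hb (onb Ha i) (onb Ha j)
  set A : onbIndex Ha → onbIndex Ha → HilbertTensor Ha Hb →L[ℂ] HilbertTensor Ha Hb :=
    fun i j => rankOneTensorOne Hb (onb Ha j) (onb Ha i) with hA
  have hAn : ∀ i j, ‖A i j‖ ≤ 1 := fun i j => by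
    refine (norm_rankOneTensorOne_le _ _).trans_eq ?_
    rw [(onb Ha).orthonormal.1 i, (onb Ha).orthonormal.1 j, one_mul]
  have han : ∀ i j, ‖a i j‖ ≤ 1 := fun i j => by
    rw [← (ha1 i j).tsum_eq]
    refine tsum_of_norm_bounded hp1' fun k => ?_
    have h := norm_inner_apply_self_le (A i j) (b k)
    rw [b.orthonormal.1 k, one_pow, mul_one] at h
    rw [norm_mul]
    refine (mul_le_of_le_one_right (norm_nonneg _) (h.trans (hAn i j))).trans_eq ?_
    simp
  -- Subtracting a multiple of the identity, rather than a constant, keeps the form homogeneous, as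
  -- normalization requires. It agrees with subtracting the constant on the unit sphere.
  set B : onbIndex Ha × onbIndex Ha → HilbertTensor Ha Hb →L[ℂ] HilbertTensor Ha Hb :=
    fun q => A q.1 q.2 - a q.1 q.2 • 1 with hB
  have hBn : ∀ q, ‖B q‖ ≤ 2 := fun q => by
    refine (norm_sub_smul_one_le (A q.1 q.2) (a q.1 q.2)).trans ?_
    linarith [hAn q.1 q.2, han q.1 q.2]
  have hBψ : ∀ q ψ, ‖ψ‖ = 1 → inner ℂ ψ (B q ψ) = inner ℂ ψ (A q.1 q.2 ψ) - a q.1 q.2 := by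
    intro q ψ hψ
    simp only [hB, sub_apply, smul_apply, one_apply_eq_self]
    rw [inner_sub_right, inner_smul_right, inner_self_eq_norm_sq_to_K, hψ]
    simp
  have htr : ∀ q, HasSum (fun n => (p n : ℂ) * inner ℂ (b n) (B q (b n))) 0 := fun q => by
    have h := (ha1 q.1 q.2).sub ((Complex.hasSum_ofReal.mpr hp1').mul_right (a q.1 q.2))
    rw [Complex.ofReal_one, one_mul, sub_self] at h
    refine h.congr_fun fun n => ?_
    rw [hBψ q _ (b.orthonormal.1 n), mul_sub]
  -- Chosen so that `d * η` is the radicand of the claim. The failure probability is then at most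
  -- `16 d² t / η = (16 / 28) δ / d² ≤ δ`.
  set η : ℝ := 28 * d ^ 4 * t / δ with hη
  have hηpos : 0 < η := by positivity
  obtain ⟨hmain, hfinite⟩ := one_sub_le_GAP_real hρ b hb hG B hBn htr hηpos
  have hδ' : 16 * (Fintype.card (onbIndex Ha × onbIndex Ha) : ℝ) * t / η ≤ δ := by
    rw [Fintype.card_prod, hcard, Nat.cast_mul, ← hddef, div_le_iff₀ hηpos, hη,
      mul_div_cancel₀ _ hδ.ne']
    have h2 : d * d ≤ d ^ 4 := by nlinarith [mul_le_mul hd1 hd1 zero_le_one (by linarith)]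
    nlinarith [mul_le_mul_of_nonneg_right h2 htpos.le, mul_pos (by positivity : 0 < d ^ 4) htpos]
  refine (sub_le_sub_left hδ' 1).trans (hmain.trans (measureReal_mono fun ψ hψ => ?_))
  refine (traceNorm_le_sqrt _).trans (Real.sqrt_le_sqrt ?_)
  rw [hcard, ← hddef]
  have hent : ∀ q : onbIndex Ha × onbIndex Ha, inner ℂ (onb Ha q.1)
      ((reducedDensity (ψ : HilbertTensor Ha Hb) - partialTrace ρ) (onb Ha q.2)) =
      inner ℂ (ψ : HilbertTensor Ha Hb) (B q ψ) := fun q => by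
    rw [hBψ q _ (mem_sphere_zero_iff_norm.mp ψ.2), sub_apply, inner_sub_right,
      inner_reducedDensity, inner_partialTrace_eq ha2]
  simp_rw [hent]
  calc d * ∑ q, ‖inner ℂ (ψ : HilbertTensor Ha Hb) (B q ψ)‖ ^ 2 ≤ d * η :=
        mul_le_mul_of_nonneg_left hψ (by positivity)
    _ = 28 * d ^ 5 * t / δ := by rw [hη]; ring
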